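/- Let $d,m\ge 1$ be integers, $n:=2m+1$, $\mathbb E:=\mathbb R^d$ with the Euclidean norm. A chain with $N$ points is an element ${\bf P}=[p_0;\dots;p_{N-1}]\in\mathbb E^N$; put $(\Delta {\bf P})_i=p_{i+1}-p_i$, $|{\bf P}|_j=\max_i\|(\Delta^j{\bf P})_i\|$, $e=[1,0,\dots,0]\in\mathbb E$, ${\bf E}_k=[e;2e;\dots;ke]$ and ${\bf e}={\bf E}_n$. **GLUE-schemes.** Given $g_0,g_1:\mathbb E^{m+1}\to\mathbb E$, define ${\bf G}$ on chains with $N\ge n$ points by ${\bf G}({\bf P})={\bf P}'$ with $p'_{2i+\lambda}=g_\lambda(p_i,\dots,p_{i+m})$, $0\le i<N-m$, $\lambda\in\{0,1\}$. ${\bf G}$ is a GLUE-scheme with spread $n$ and regularity parameter $\nu>0$ if (i) ${\bf G}$ commutes with all similarities $p\mapsto \varrho\,pQ+s$ ($\varrho>0$, $Q$ orthogonal, $s\in\mathbb E$) applied pointwise; (ii) $g_0,g_1$ are $C^{1,\nu}$ in a neighborhood of ${\bf E}_{m+1}$; (iii) ${\bf G}({\bf e})=({\bf E}_{n+1}+(m+\tau)e)/2$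 for some $\tau\in[0,1)$. Write ${\bf P}^\ell={\bf G}^\ell({\bf P})$ with points $p^\ell_i$. **Straightening.** Let $\Pi$ be the orthogonal projection of $\mathbb E^n$ (inner product $\sum_i\langle p_i,q_i\rangle$) onto $\{{\bf p}:\Delta^2{\bf p}=0\}$. For ${\bf p}\in\mathbb E^n$ let $\kappa({\bf p})=|{\bf p}|_2/|\Pi{\bf p}|_1$ if $\Delta\Pi{\bf p}\ne0$ and $\kappa({\bf p})=\infty$ otherwise; for a longer chain, $\kappa({\bf P})$ is the maximum of $\kappa$ over all subchains of $n$ consecutive points. ${\bf P}$ is straightened by ${\bf G}$ if $\kappa({\bf P}^\ell)\to0$ as $\ell\to\infty$. **Smoothness.** Let ${\bf P}$ have $N\ge n$ points, $I=(0,N-n+1)$ and $I_z=[z,N-n+1-z]$. For $k\in\mathbb N_0$ and $\alpha\in(0,1]$, ${\bf G}$ is $C^{k,\alpha}$ at ${\bf P}$ if there is a continuous $\Phi:\mathbb R\to\mathbb E$ such that, for every $z>0$, $\max\{\|\Phi(2^{-\ell}i)-p^\ell_i\| : i\in\mathbb N_0,\ 2^{-\ell}i\in I_z\}\to0$ as $\ell\to\infty$,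 and such that $\Phi$ is $C^k$ on $I$ and, for some $h_0>0$ and every $z>0$, $\sup_{0<h\le h_0}h^{-\alpha}\max_{t\in I_{z+h/2}}\|\partial^k\Phi(t+h/2)-\partial^k\Phi(t-h/2)\|<\infty$. It is almost $C^{k,\alpha}$ at ${\bf P}$ if it is $C^{k,\alpha'}$ at ${\bf P}$ for all $0<\alpha'<\alpha$. The same notions are used for every scheme given by a pair of rules. A linear scheme ${\bf A}$, i.e. one with rules $a_\lambda(p_0,\dots,p_m)=\sum_{j=0}^m a_{\lambda,j}p_j$ with real weights, is almost $C^{k,\alpha}$ if it is almost $C^{k,\alpha}$ at every chain with at least $n$ points and is non-degenerate: if the iterates of a bi-infinite sequence $(p_i)_{i\in\mathbb Z}$ in $\mathbb E$, refined by the same rules for all $i\in\mathbb Z$, converge (locally uniformly in the parameter $2^{-\ell}i$) to a constant, then the sequence $(p_i)$ is constant. **Linear companion.** Let ${\bf g}_\lambda:\mathbb E^n\to\mathbb E^n$ map ${\bf p}$ to the points with indices $\lambda,\dots,\lambda+n-1$ of ${\bf G}({\bf p})$. ${\bf G}$ is locally linear if there are real $n\times n$ matrices $A_0,A_1$ with $D{\bf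 g}_\lambda({\bf e})\cdot{\bf p}'=A_\lambda{\bf p}'$ for all ${\bf p}'\in\mathbb E^n$ and $\lambda\in\{0,1\}$. The linear scheme ${\bf A}$ corresponding to $(A_0,A_1)$, whose weights $a_{\lambda,0},\dots,a_{\lambda,m}$ are the first $m+1$ entries of the first row of $A_\lambda$, is its linear companion. **Theorem.** Let ${\bf G}$ be a locally linear GLUE-scheme with linear companion ${\bf A}$, spread $n$ and regularity parameter $\nu$, and let $\alpha\in(0,1]$. If the chain ${\bf P}\in\mathbb E^N$, $N\ge n$, is straightened by ${\bf G}$ and if ${\bf A}$ is almost $C^{2,\alpha}$, then ${\bf G}$ is almost $C^{2,\beta}$ at ${\bf P}$, where $\beta:=\min\{\alpha,\nu\}$. -/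

import Mathlib

open Filter Topology
open scoped ENNReal

noncomputable section

namespace Subdiv

/-! ### Points, chains, differences -/

/-- Euclidean `d`-space. A chain with `N` points is a map `Fin N → Pt d`. Note that the norm of
`Fin N → Pt d` is the maximum of the Euclidean norms of the points. -/
abbrev Pt (d : ℕ) : Type := EuclideanSpace ℝ (Fin d)

/-- The first unit vector `e`. -/
def unitVec (d : ℕ) [NeZero d] : Pt d := EuclideanSpace.single 0 1

/-- The standard linear chain `[e; 2e; …; Ne]`. -/
def stdChain (d N : ℕ) [NeZero d] : Fin N → Pt d := fun i => ((i : ℝ) + 1) • unitVec d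

/-- The forward difference of a chain, which has one point less. -/
def diff {d N : ℕ} (p : Fin N → Pt d) : Fin (N - 1) → Pt d :=
  fun i => p ⟨i + 1, by omega⟩ - p ⟨i, by omega⟩

/-- The subchain `[p_i; …; p_{i+n-1}]`. -/
def window {d N : ℕ} (n i : ℕ) (h : i + n ≤ N) (p : Fin N → Pt d) : Fin n → Pt d :=
  fun j => p ⟨i + j, by omega⟩

/-! ### Linear component and relative distortion -/

/-- The subspace of linear chains (second differences vanish) in the Euclidean space of chains
with `n` points, whose inner product is `∑ i, ⟪p i, q i⟫`. -/
def linearChains (d n : ℕ) : Submodule ℝ (PiLp 2 (fun _ : Fin n => Pt d)) where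
  carrier := {p | diff (diff (WithLp.ofLp p)) = 0}
  zero_mem' := by
    funext i
    simp [diff]
  add_mem' := by
    intro p q hp hq
    funext i
    have h1 := congrFun hp i
    have h2 := congrFun hq i
    simp only [diff, Pi.zero_apply, WithLp.ofLp_add, Pi.add_apply] at h1 h2 ⊢
    rw [← add_zero (0 : Pt d)]
    nth_rewrite 1 [← h1]
    rw [← h2]
    abel
  smul_mem' := by
    intro c p hp
    funext i
    have h1 := congrFun hp i
    simp only [diff, Pi.zero_apply, WithLp.ofLp_smul, Pi.smul_apply] at h1 ⊢
    rw [← smul_sub, ← smul_sub, ← smul_sub, h1, smul_zero]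

/-- The linear component of a chain: its orthogonal projection onto the linear chains. -/
def linPart {d n : ℕ} (p : Fin n → Pt d) : Fin n → Pt d :=
  WithLp.ofLp ((linearChains d n).starProjection (WithLp.toLp 2 p))

open Classical in
/-- Relative distortion of a chain with `n` points: the maximal norm of the second differences
divided by the maximal norm of the first differences of the linear component, and `∞` if the
linear component is constant. -/
def distortion {d n : ℕ} (p : Fin n → Pt d) : ℝ≥0∞ :=
  if diff (linPart p) ≠ 0 then ENNReal.ofReal (‖diff (diff p)‖ / ‖diff (linPart p)‖) else ∞

/-- Relative distortion of a chain: the maximum over all its subchains with `n` points. -/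
def maxDistortion {d N : ℕ} (n : ℕ) (p : Fin N → Pt d) : ℝ≥0∞ :=
  ⨆ (i : ℕ) (h : i + n ≤ N), distortion (window n i h p)

/-! ### Subdivision -/

/-- The pair of rules `g_0, g_1` of a local, uniform, binary subdivision scheme. Each rule computes
a new point from `m + 1` consecutive old ones. -/
abbrev Rules (d m : ℕ) : Type := Fin 2 → (Fin (m + 1) → Pt d) → Pt d

/-- The spread `n = 2 m + 1`. -/
abbrev spread (m : ℕ) : ℕ := 2 * m + 1

/-- The subdivision map: the new points are `p'_{2i+s} = g_s (p_i, …, p_{i+m})` for `s ∈ {0, 1}`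
and `0 ≤ i < N - m`, so there are `2 N - n + 1 = 2 (N - m)` of them. -/
def subdivide {d m N : ℕ} (g : Rules d m) (p : Fin N → Pt d) : Fin (2 * (N - m)) → Pt d :=
  fun k => g (if (k : ℕ) % 2 = 0 then 0 else 1) (fun j => p ⟨(k : ℕ) / 2 + j, by omega⟩)

/-- The number of points at level `l`, starting from `N` points. -/
def len (m N : ℕ) : ℕ → ℕ
  | 0 => N
  | l + 1 => 2 * (len m N l - m)

/-- The subdivision iterates `P^l` of the chain `P`. -/
def iter {d m N : ℕ} (g : Rules d m) (P : Fin N → Pt d) : (l : ℕ) → Fin (len m N l) → Pt d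
  | 0 => P
  | l + 1 => subdivide g (iter g P l)

/-- The two self-maps of the space of chains with `n = 2 m + 1` points: the result of subdivision
has `n + 1` points, and the map with index `s ∈ {0, 1}` picks the `n` points from position `s`. -/
def selfMap {d m : ℕ} (g : Rules d m) (s : Fin 2) (p : Fin (spread m) → Pt d) :
    Fin (spread m) → Pt d :=
  window (spread m) s (by simp only [spread]; omega) (subdivide g p)

/-- The similarity `p ↦ ρ Q p + t`. -/
def similarity {d : ℕ} (ρ : ℝ) (Q : Pt d ≃ₗᵢ[ℝ] Pt d) (t : Pt d) : Pt d → Pt d :=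
  fun p => ρ • Q p + t

/-- The function `f` is `C^{1,ν}` in a neighborhood of `x`. -/
def IsC1HolderNear {E F : Type*} [NormedAddCommGroup E] [NormedSpace ℝ E] [NormedAddCommGroup F]
    [NormedSpace ℝ F] (ν : ℝ) (f : E → F) (x : E) : Prop :=
  ∃ U : Set E, IsOpen U ∧ x ∈ U ∧ ContDiffOn ℝ 1 f U ∧
    ∃ C : ℝ, ∀ y ∈ U, ∀ z ∈ U, ‖fderiv ℝ f y - fderiv ℝ f z‖ ≤ C * ‖y - z‖ ^ ν

/-- The rules `g` define a GLUE-scheme with spread `2 m + 1` and regularity parameter `ν`.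
Locality and uniformity are built into `subdivide`. -/
structure IsGLUE {d m : ℕ} [NeZero d] (g : Rules d m) (ν : ℝ) : Prop where
  /-- Subdivision commutes with similarities. -/
  geometric : ∀ N : ℕ, spread m ≤ N → ∀ (P : Fin N → Pt d) (ρ : ℝ), 0 < ρ →
    ∀ (Q : Pt d ≃ₗᵢ[ℝ] Pt d) (t : Pt d),
      subdivide g (fun i => similarity ρ Q t (P i)) =
        fun k => similarity ρ Q t (subdivide g P k)
  /-- The regularity parameter is positive. -/
  regularity_pos : 0 < ν
  /-- The rules are `C^{1,ν}` near the standard linear chain with `m + 1` points. -/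
  regular : ∀ s : Fin 2, IsC1HolderNear ν (g s) (stdChain d (m + 1))
  /-- The standard linear chain is scaled by `1/2` and translated by `(m + τ) e / 2`. -/
  equilinear : ∃ τ : ℝ, 0 ≤ τ ∧ τ < 1 ∧ ∀ k,
    subdivide g (stdChain d (spread m)) k = ((((k : ℕ) : ℝ) + 1 + (m + τ)) / 2) • unitVec d

/-- The chain `P` is straightened: the relative distortion of the iterates is a null sequence. -/
def IsStraightened {d m N : ℕ} (g : Rules d m) (P : Fin N → Pt d) : Prop :=
  Tendsto (fun l => maxDistortion (spread m) (iter g P l)) atTop (𝓝 0)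

/-! ### Limit curves and their smoothness on the interval `(0, N - n + 1) = (0, N - 2 m)` -/

/-- The continuous function `Φ` is a limit curve for the initial chain `P`: for every `z > 0`,
the maximum of `‖Φ (2^{-l} i) - p^l_i‖` over the indices `i` with
`2^{-l} i ∈ [z, N - 2 m - z]` tends to `0` as `l → ∞`. -/
def IsLimitCurve {d m N : ℕ} (g : Rules d m) (P : Fin N → Pt d) (Φ : ℝ → Pt d) : Prop :=
  Continuous Φ ∧ ∀ z : ℝ, 0 < z → ∀ ε : ℝ, 0 < ε → ∃ l₀ : ℕ, ∀ l : ℕ, l₀ ≤ l →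
    ∀ i : Fin (len m N l), z ≤ (i : ℝ) / 2 ^ l → (i : ℝ) / 2 ^ l ≤ (N : ℝ) - 2 * m - z →
      ‖Φ ((i : ℝ) / 2 ^ l) - iter g P l i‖ ≤ ε

/-- The curve `Φ` is `C^{k,α}` on the interval `(0, L)`: it is `C^k` there, and for every `z > 0`
the modulus of continuity of its `k`-th derivative on `[z, L - z]` is `O(h^α)`,
`0 < h ≤ h₀`. -/
def IsHolderCurve {d : ℕ} (k : ℕ) (α L : ℝ) (Φ : ℝ → Pt d) : Prop :=
  ContDiffOn ℝ k Φ (Set.Ioo 0 L) ∧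
    ∃ h₀ : ℝ, 0 < h₀ ∧ ∀ z : ℝ, 0 < z → ∃ C : ℝ, ∀ h : ℝ, 0 < h → h ≤ h₀ →
      ∀ t ∈ Set.Icc (z + h / 2) (L - (z + h / 2)),
        ‖iteratedDeriv k Φ (t + h / 2) - iteratedDeriv k Φ (t - h / 2)‖ ≤ C * h ^ α

/-- The scheme is `C^{k,α}` at the chain `P`. -/
def IsHolderAt {d m N : ℕ} (g : Rules d m) (k : ℕ) (α : ℝ) (P : Fin N → Pt d) : Prop :=
  ∃ Φ : ℝ → Pt d, IsLimitCurve g P Φ ∧ IsHolderCurve k α ((N : ℝ) - 2 * m) Φ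

/-- The scheme is almost `C^{k,α}` at the chain `P`. -/
def IsAlmostHolderAt {d m N : ℕ} (g : Rules d m) (k : ℕ) (α : ℝ) (P : Fin N → Pt d) : Prop :=
  ∀ α' : ℝ, 0 < α' → α' < α → IsHolderAt g k α' P

/-! ### Linear schemes -/

/-- The rules of the linear scheme with weights `a`. -/
def linearRules (d : ℕ) {m : ℕ} (a : Fin 2 → Fin (m + 1) → ℝ) : Rules d m :=
  fun s p => ∑ j, a s j • p j

/-- Subdivision of a bi-infinite sequence of points: `p'_{2i+s} = g_s (p_i, …, p_{i+m})`
for all integers `i`. -/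
def subdivideZ {d m : ℕ} (g : Rules d m) (p : ℤ → Pt d) : ℤ → Pt d :=
  fun k => g (if k % 2 = 0 then 0 else 1) (fun j => p (k / 2 + (j : ℕ)))

/-- The iterates of the bi-infinite sequence `p` converge to the constant `c`, uniformly on compact
parameter intervals. -/
def HasConstantLimit {d m : ℕ} (g : Rules d m) (p : ℤ → Pt d) (c : Pt d) : Prop :=
  ∀ r : ℝ, 0 < r → ∀ ε : ℝ, 0 < ε → ∃ l₀ : ℕ, ∀ l : ℕ, l₀ ≤ l →
    ∀ i : ℤ, |(i : ℝ) / 2 ^ l| ≤ r → ‖c - (subdivideZ g)^[l] p i‖ ≤ ε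

/-- A constant limit is attained only for constant (bi-infinite) initial data. -/
def IsNondegenerate {d m : ℕ} (g : Rules d m) : Prop :=
  ∀ (p : ℤ → Pt d) (c : Pt d), HasConstantLimit g p c → ∀ i j : ℤ, p i = p j

/-- The linear scheme with weights `a` is almost `C^{k,α}`: it is so at all chains with at least
`n` points, and it is non-degenerate. -/
def IsAlmostHolderLinear (d : ℕ) {m : ℕ} (a : Fin 2 → Fin (m + 1) → ℝ) (k : ℕ) (α : ℝ) : Prop :=
  (∀ (N : ℕ) (P : Fin N → Pt d), spread m ≤ N → IsAlmostHolderAt (linearRules d a) k α P) ∧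
    IsNondegenerate (linearRules d a)

/-- A real `n × n` matrix as a linear map on chains with `n` points. -/
def matrixAction (d : ℕ) {n : ℕ} (A : Matrix (Fin n) (Fin n) ℝ) :
    (Fin n → Pt d) →L[ℝ] (Fin n → Pt d) :=
  ContinuousLinearMap.pi fun i => ∑ j, A i j • ContinuousLinearMap.proj j

/-- The scheme is locally linear with matrices `A 0`, `A 1`: the derivatives of the two self-maps
at the standard linear chain act on chains by these matrices. -/
def IsLocallyLinear {d m : ℕ} [NeZero d] (g : Rules d m)
    (A : Fin 2 → Matrix (Fin (spread m)) (Fin (spread m)) ℝ) : Prop :=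
  ∀ s : Fin 2, HasFDerivAt (selfMap g s) (matrixAction d (A s)) (stdChain d (spread m))

/-- The weights of the linear scheme corresponding to a pair of matrices: the first point of the
self-map with index `s` is the value of the rule `s` at the first `m + 1` points, so the weights
are the entries `0, …, m` of the first row of the matrix `A s`. -/
def companionWeights {m : ℕ} (A : Fin 2 → Matrix (Fin (spread m)) (Fin (spread m)) ℝ) :
    Fin 2 → Fin (m + 1) → ℝ :=
  fun s j => A s 0 ⟨j, by simp only [spread]; omega⟩

end Subdiv

end

/-! By `perturbed_deviation`, the iterates are those of the linear companion with a term `r l` added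
at each level: the deviation of one step of the scheme from a linear step. The limit curve is thus
the sum over `l` of combinations of integer translates of the companion's basic limit function `φ`,
evaluated at `2 ^ l * t`. Two derivatives cost `4 ^ l` and a Hölder quotient costs another `(2 ^ β)
^ l`. Hence for `β < min α ν` it suffices that `(4 * 2 ^ β) ^ l * sup ‖r l‖` is summable
(`perturbedCurve_holder`, `summable_deviation`).

Similarity invariance and `C^{1,ν}` regularity bound the deviation by `C (D / |u|)^ν D`, where `D`
bounds the second differences near an edge `u` (`exists_rule_sub_linearSub_le`). What is needed is
`D ~ 4^{-l}` and `|u| ~ 2^{-l}`, up to factors `(1 ± ε)^l`.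

For the companion, the curve of the second differences at level `l` is a second difference with step
`2^{-l}` of a fixed `C^2` curve. Non-degeneracy and compactness bound coefficients by their curve
(`exists_norm_le_of_curve`), which gives the decay `4^{-l}`. Adding up levels, `D ≤ C S_l / 4^l`
with `S_l = ∑_{k ≤ l} 4^k sup ‖r k‖`. Straightening makes `D / |u|` as small as desired, so the
deviation is a tiny multiple of `D` and `S_{l+1} ≤ (1 + ε) S_l`. It also keeps edges from shrinking
faster than `((1 - ε) / 2)^l` (`exists_le_norm_first_diff`). Inserting both rates, the deviation is
`O(θ^l)` with `θ` close to `2^{-ν} / 4`, which is enough since `β < ν`. -/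

noncomputable section

namespace Subdiv

/-! ### Linear subdivision of bi-infinite sequences -/

section LinearScheme

variable {E : Type*} [AddCommGroup E] [Module ℝ E] {m : ℕ}

/-- The rule used for the point with index `k`. -/
def parity (k : ℤ) : Fin 2 := if k % 2 = 0 then 0 else 1

/-- The linear scheme with weights `a`, acting on bi-infinite sequences. -/
def linearSub (E : Type*) [AddCommGroup E] [Module ℝ E] {m : ℕ} (a : Fin 2 → Fin (m + 1) → ℝ) :
    Module.End ℝ (ℤ → E) where
  toFun q k := ∑ j, a (parity k) j • q (k / 2 + (j : ℕ))
  map_add' p q := by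
    funext k
    simp [smul_add, Finset.sum_add_distrib]
  map_smul' c q := by
    funext k
    simp [Finset.smul_sum, smul_comm c]

lemma linearSub_apply (a : Fin 2 → Fin (m + 1) → ℝ) (q : ℤ → E) (k : ℤ) :
    linearSub E a q k = ∑ j, a (parity k) j • q (k / 2 + (j : ℕ)) := rfl

lemma linearSub_pow_succ (a : Fin 2 → Fin (m + 1) → ℝ) (l : ℕ) (q : ℤ → E) :
    (linearSub E a ^ (l + 1)) q = (linearSub E a ^ l) (linearSub E a q) := by
  rw [pow_succ, Module.End.mul_apply]

lemma linearSub_pow_succ' (a : Fin 2 → Fin (m + 1) → ℝ) (l : ℕ) (q : ℤ → E) :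
    (linearSub E a ^ (l + 1)) q = linearSub E a ((linearSub E a ^ l) q) := by
  rw [pow_succ', Module.End.mul_apply]

lemma subdivideZ_linearRules {d : ℕ} (a : Fin 2 → Fin (m + 1) → ℝ) :
    subdivideZ (linearRules d a) = linearSub (Pt d) a := rfl

lemma iterate_subdivideZ_linearRules {d : ℕ} (a : Fin 2 → Fin (m + 1) → ℝ) (l : ℕ) :
    (subdivideZ (linearRules d a))^[l] = (linearSub (Pt d) a ^ l : Module.End ℝ (ℤ → Pt d)) := by
  rw [subdivideZ_linearRules, Module.End.coe_pow]

/-- The `l`-th iterate at `i` depends only on the initial points with indices between `⌊i / 2^l⌋`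
and `⌊i / 2^l⌋ + 2 m`. -/
lemma linearSub_pow_congr (a : Fin 2 → Fin (m + 1) → ℝ) (l : ℕ) :
    ∀ (p q : ℤ → E) (i : ℤ), (∀ j, i / 2 ^ l ≤ j → j ≤ i / 2 ^ l + 2 * m → p j = q j) →
      (linearSub E a ^ l) p i = (linearSub E a ^ l) q i := by
  induction l with
  | zero =>
    intro p q i h
    simpa using h i (by simp) (by simp)
  | succ l ih =>
    intro p q i h
    rw [linearSub_pow_succ, linearSub_pow_succ]
    refine ih _ _ i fun k hk1 hk2 => ?_
    -- Floors nest, and the width `2 m` is the fixed point of `w ↦ w / 2 + m`, so the window does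
    -- not grow.
    have hdiv : i / 2 ^ (l + 1) = i / 2 ^ l / 2 := by
      rw [pow_succ, Int.ediv_ediv_of_nonneg (by positivity)]
    rw [hdiv] at h
    rw [linearSub_apply, linearSub_apply]
    refine Finset.sum_congr rfl fun j _ => ?_
    have := j.2
    rw [h _ (by omega) (by omega)]

lemma linearSub_pow_shift (a : Fin 2 → Fin (m + 1) → ℝ) (l : ℕ) :
    ∀ (q : ℤ → E) (c i : ℤ), (linearSub E a ^ l) (fun j => q (j + c)) i =
      (linearSub E a ^ l) q (i + 2 ^ l * c) := by
  induction l with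
  | zero => intro q c i; simp
  | succ l ih =>
    intro q c i
    have h : linearSub E a (fun j => q (j + c)) = fun j => linearSub E a q (j + 2 * c) := by
      funext k
      have h1 : parity (k + 2 * c) = parity k := by
        unfold parity
        congr 2
        omega
      rw [linearSub_apply, linearSub_apply, h1]
      refine Finset.sum_congr rfl fun j _ => ?_
      congr 2
      omega
    rw [linearSub_pow_succ, linearSub_pow_succ, h, ih,
      show (2 : ℤ) ^ l * (2 * c) = 2 ^ (l + 1) * c by ring]

/-- The scalar sequence with value `1` at `0` and `0` elsewhere. -/
def deltaSeq : ℤ → ℝ := Pi.single 0 1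

/-- The iterates of the scalar delta sequence. -/
def mask (a : Fin 2 → Fin (m + 1) → ℝ) (l : ℕ) : ℤ → ℝ := (linearSub ℝ a ^ l) deltaSeq

/-- Such an `i` has a dependence window that misses `0`. In the parameter `i / 2 ^ l` the mask lives
in `[-2 m, 1)`. -/
lemma mask_eq_zero (a : Fin 2 → Fin (m + 1) → ℝ) (l : ℕ) (i : ℤ)
    (h : 2 ^ l ≤ i ∨ i + 2 * m * 2 ^ l < 0) : mask a l i = 0 := by
  have h2 : (0 : ℤ) < 2 ^ l := by positivity
  have : mask a l i = (linearSub ℝ a ^ l) 0 i := by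
    refine linearSub_pow_congr a l _ _ i fun j h1 h3 => ?_
    have hj : j ≠ 0 := by
      rintro rfl
      rcases h with h | h
      · have : 1 ≤ i / 2 ^ l := by
          rw [Int.le_ediv_iff_mul_le h2]; omega
        omega
      · have : i / 2 ^ l < -(2 * m) := by
          rw [Int.ediv_lt_iff_lt_mul h2]
          linarith
        omega
    simp [deltaSeq, hj]
  rw [this, map_zero]
  rfl

/-- Real weights act on vectors through scalars, so one scalar mask per level describes the scheme
in every dimension. -/
lemma linearSub_pow_smul_const (a : Fin 2 → Fin (m + 1) → ℝ) (l : ℕ) :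
    ∀ (c : ℤ → ℝ) (v : E) (i : ℤ), (linearSub E a ^ l) (fun j => c j • v) i =
      (linearSub ℝ a ^ l) c i • v := by
  induction l with
  | zero => intro c v i; simp
  | succ l ih =>
    intro c v i
    have h : linearSub E a (fun j => c j • v) = fun j => linearSub ℝ a c j • v := by
      funext k
      simp only [linearSub_apply, Finset.sum_smul, smul_smul, smul_eq_mul]
    rw [linearSub_pow_succ, linearSub_pow_succ, h, ih]

lemma linearSub_pow_single (a : Fin 2 → Fin (m + 1) → ℝ) (l : ℕ) (j : ℤ) (v : E) (i : ℤ) :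
    (linearSub E a ^ l) (Pi.single j v) i = mask a l (i - 2 ^ l * j) • v := by
  have h : (Pi.single j v : ℤ → E) = fun k => deltaSeq (k + -j) • v := by
    funext k
    by_cases hk : k = j
    · subst hk; simp [deltaSeq]
    · have : k + -j ≠ 0 := by omega
      simp [deltaSeq, hk, this]
  rw [h, linearSub_pow_smul_const a l (fun k => deltaSeq (k + -j)),
    linearSub_pow_shift a l deltaSeq, mask, mul_neg, ← sub_eq_add_neg]

/-- The iterates are combinations of shifts of the mask. -/
lemma linearSub_pow_eq_finsum (a : Fin 2 → Fin (m + 1) → ℝ) (l : ℕ) (q : ℤ → E) (i : ℤ) :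
    (linearSub E a ^ l) q i = ∑ᶠ j : ℤ, mask a l (i - 2 ^ l * j) • q j := by
  have h2 : (0 : ℤ) < 2 ^ l := by positivity
  set s := Finset.Icc (i / 2 ^ l) (i / 2 ^ l + 2 * m) with hs
  -- Only finitely many coefficients reach `i`, so `q` may be replaced by a finite sum of one-point
  -- sequences.
  have h1 : (linearSub E a ^ l) q i = (linearSub E a ^ l) (∑ j ∈ s, Pi.single j (q j)) i := by
    refine linearSub_pow_congr a l _ _ i fun j hj1 hj2 => ?_
    rw [Finset.sum_apply, Finset.sum_eq_single j]
    · simp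
    · intro k _ hk
      simp [hk.symm]
    · intro hj
      exact absurd (Finset.mem_Icc.2 ⟨hj1, hj2⟩) hj
  rw [h1, map_sum, Finset.sum_apply, finsum_eq_sum_of_support_subset (s := s)]
  · exact Finset.sum_congr rfl fun j _ => linearSub_pow_single a l j (q j) i
  · intro j hj
    by_contra hjs
    apply hj
    have : mask a l (i - 2 ^ l * j) = 0 := by
      apply mask_eq_zero
      have e := Int.emod_add_mul_ediv i (2 ^ l)
      have e1 := Int.emod_nonneg i h2.ne'
      have e2 := Int.emod_lt_of_pos i h2
      simp only [hs, Finset.coe_Icc, Set.mem_Icc, not_and_or, not_le] at hjs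
      rcases hjs with h | h
      · left
        nlinarith
      · right
        nlinarith
    simp [this]

end LinearScheme

/-! ### Chains as bi-infinite sequences -/

/-- The extension of a chain by zero. -/
def extend {d N : ℕ} (P : Fin N → Pt d) : ℤ → Pt d :=
  fun i => if h : 0 ≤ i ∧ i < N then P ⟨i.toNat, by omega⟩ else 0

lemma extend_apply {d N : ℕ} (P : Fin N → Pt d) (i : Fin N) : extend P (i : ℕ) = P i := by
  have : (0 : ℤ) ≤ (i : ℕ) ∧ ((i : ℕ) : ℤ) < N := ⟨by omega, by exact_mod_cast i.2⟩
  simp [extend]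

lemma extend_of_mem {d N : ℕ} (P : Fin N → Pt d) {i : ℤ} (h0 : 0 ≤ i) (h1 : i < N) :
    extend P i = P ⟨i.toNat, by omega⟩ := by
  rw [extend, dif_pos ⟨h0, h1⟩]

lemma extend_subdivide {d m N : ℕ} (g : Rules d m) (P : Fin N → Pt d) {k : ℤ} (h0 : 0 ≤ k)
    (h1 : k < (2 * (N - m) : ℕ)) :
    extend (subdivide g P) k = g (parity k) fun j => extend P (k / 2 + (j : ℕ)) := by
  rw [extend_of_mem _ h0 h1, subdivide]
  have hp : (if k.toNat % 2 = 0 then 0 else 1 : Fin 2) = parity k := by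
    unfold parity
    congr 1
    apply propext
    omega
  simp only [hp]
  congr 1
  funext j
  have := j.2
  rw [extend_of_mem _ (by omega) (by omega)]
  congr 1
  ext
  simp only
  omega

/-- `2 m` is the fixed point of `N ↦ 2 (N - m)`, and the excess over it doubles at each level. -/
lemma len_eq {m N : ℕ} (h : 2 * m ≤ N) (l : ℕ) : len m N l = 2 ^ l * (N - 2 * m) + 2 * m := by
  induction l with
  | zero => simp [len, h]
  | succ l ih =>
    have : 2 ^ l * (N - 2 * m) + 2 * m - m = 2 ^ l * (N - 2 * m) + m := by omega
    rw [len, ih, this]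
    ring

lemma extend_iter_succ {d m N : ℕ} (g : Rules d m) (P : Fin N → Pt d) (l : ℕ) {k : ℤ} (h0 : 0 ≤ k)
    (h1 : k < len m N (l + 1)) :
    extend (iter g P (l + 1)) k = g (parity k) fun j => extend (iter g P l) (k / 2 + (j : ℕ)) :=
  extend_subdivide g (iter g P l) h0 h1

/-- Indices in range never read beyond the chain, so smoothness at finite chains transfers to
bi-infinite sequences. -/
lemma extend_iter_linearRules {d m N : ℕ} (a : Fin 2 → Fin (m + 1) → ℝ) (P : Fin N → Pt d)
    (l : ℕ) : ∀ k : ℤ, 0 ≤ k → k < len m N l →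
      extend (iter (linearRules d a) P l) k = (linearSub (Pt d) a ^ l) (extend P) k := by
  induction l with
  | zero => intro k _ _; rfl
  | succ l ih =>
    intro k h0 h1
    rw [linearSub_pow_succ', extend_iter_succ _ _ _ h0 h1, linearSub_apply, linearRules]
    refine Finset.sum_congr rfl fun j _ => ?_
    have := j.2
    simp only [len] at h1
    rw [ih _ (by omega) (by omega)]

/-! ### The basic limit function -/

/-- The function `φ` with derivatives `φ₁` and `φ₂` is the basic limit function of the linear scheme
with weights `a`, and `φ₂` is Hölder continuous with exponent `β`. -/
structure IsBasicLimit {m : ℕ} (a : Fin 2 → Fin (m + 1) → ℝ) (β : ℝ) (φ φ₁ φ₂ : ℝ → ℝ) :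
    Prop where
  support : ∀ t : ℝ, 2 * m + 1 < |t| → φ t = 0
  support₁ : ∀ t : ℝ, 2 * m + 1 < |t| → φ₁ t = 0
  support₂ : ∀ t : ℝ, 2 * m + 1 < |t| → φ₂ t = 0
  hasDerivAt : ∀ t, HasDerivAt φ (φ₁ t) t
  hasDerivAt₁ : ∀ t, HasDerivAt φ₁ (φ₂ t) t
  holder : ∃ C, 0 ≤ C ∧ ∀ s t, |φ₂ s - φ₂ t| ≤ C * |s - t| ^ β
  limit : ∀ ε, 0 < ε → ∃ l₀ : ℕ, ∀ l, l₀ ≤ l → ∀ i : ℤ, |mask a l i - φ (i / 2 ^ l)| ≤ ε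

/-- The function `f` on `(-R, R)`, extended by zero. -/
def cutoff (R : ℝ) (f : ℝ → ℝ) : ℝ → ℝ := fun t => if |t| < R then f t else 0

lemma cutoff_of_lt {R t : ℝ} {f : ℝ → ℝ} (h : |t| < R) : cutoff R f t = f t := if_pos h

lemma cutoff_eq_zero {R r t : ℝ} {f : ℝ → ℝ} (hf : ∀ t, r < |t| → |t| < R → f t = 0)
    (h : r < |t|) : cutoff R f t = 0 := by
  unfold cutoff
  split_ifs with h1
  · exact hf t h h1
  · rfl

lemma eventually_abs_lt {R t : ℝ} (h : |t| < R) : ∀ᶠ s in 𝓝 t, |s| < R :=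
  (isOpen_lt continuous_abs continuous_const).mem_nhds h

lemma eventually_lt_abs {r t : ℝ} (h : r < |t|) : ∀ᶠ s in 𝓝 t, r < |s| :=
  (isOpen_lt continuous_const continuous_abs).mem_nhds h

lemma deriv_eq_zero_of_annulus {R r : ℝ} {f f' : ℝ → ℝ}
    (hd : ∀ t, |t| < R → HasDerivAt f (f' t) t) (hf : ∀ t, r < |t| → |t| < R → f t = 0) :
    ∀ t, r < |t| → |t| < R → f' t = 0 := by
  intro t h1 h2
  refine (hd t h2).unique ((hasDerivAt_const t (0 : ℝ)).congr_of_eventuallyEq ?_)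
  filter_upwards [eventually_abs_lt h2, eventually_lt_abs h1] with s hs1 hs2
  exact hf s hs2 hs1

/-- On the annulus `r < |t| < R` both pieces vanish, so gluing with zero loses no smoothness. -/
lemma hasDerivAt_cutoff {R r : ℝ} (hr : r < R) {f f' : ℝ → ℝ}
    (hd : ∀ t, |t| < R → HasDerivAt f (f' t) t) (hf : ∀ t, r < |t| → |t| < R → f t = 0) (t : ℝ) :
    HasDerivAt (cutoff R f) (cutoff R f' t) t := by
  by_cases h : |t| < R
  · rw [cutoff_of_lt h]
    refine (hd t h).congr_of_eventuallyEq ?_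
    filter_upwards [eventually_abs_lt h] with s hs
    exact cutoff_of_lt hs
  · have h1 : r < |t| := hr.trans_le (not_lt.1 h)
    rw [cutoff_eq_zero (deriv_eq_zero_of_annulus hd hf) h1]
    refine (hasDerivAt_const t (0 : ℝ)).congr_of_eventuallyEq ?_
    filter_upwards [eventually_lt_abs h1] with s hs
    exact cutoff_eq_zero hf hs

lemma continuous_cutoff {R r : ℝ} (hr : r < R) {f : ℝ → ℝ}
    (hc : ∀ t, |t| < R → ContinuousAt f t) (hf : ∀ t, r < |t| → |t| < R → f t = 0) :
    Continuous (cutoff R f) := by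
  refine continuous_iff_continuousAt.2 fun t => ?_
  by_cases h : |t| < R
  · refine (hc t h).congr ?_
    filter_upwards [eventually_abs_lt h] with s hs
    exact (cutoff_of_lt hs).symm
  · have h1 : r < |t| := hr.trans_le (not_lt.1 h)
    refine (continuousAt_const (y := (0 : ℝ))).congr ?_
    filter_upwards [eventually_lt_abs h1] with s hs
    exact (cutoff_eq_zero hf hs).symm

lemma exists_bound_of_support {f : ℝ → ℝ} (hf : Continuous f) {r : ℝ}
    (h : ∀ t, r < |t| → f t = 0) : ∃ M, 0 < M ∧ ∀ t, |f t| ≤ M := by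
  obtain ⟨M, hM⟩ := (isCompact_Icc (a := -r) (b := r)).exists_bound_of_continuousOn hf.continuousOn
  refine ⟨max M 1, by positivity, fun t => ?_⟩
  by_cases ht : r < |t|
  · rw [h t ht, abs_zero]
    positivity
  · exact (hM t (abs_le.1 (not_lt.1 ht))).trans (le_max_left _ _)

/-- A compactly supported function that is Hölder continuous at short distances is Hölder
continuous. -/
lemma exists_holder_of_local {f : ℝ → ℝ} (hf : Continuous f) {r h₁ β C : ℝ}
    (h : ∀ t, r < |t| → f t = 0) (hh : 0 < h₁) (hβ : 0 < β)
    (hC : ∀ s t, s < t → t - s ≤ h₁ → |f t - f s| ≤ C * (t - s) ^ β) :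
    ∃ C', 0 ≤ C' ∧ ∀ s t, |f s - f t| ≤ C' * |s - t| ^ β := by
  obtain ⟨M, hM0, hM⟩ := exists_bound_of_support hf h
  have hp : 0 < h₁ ^ β := Real.rpow_pos_of_pos hh β
  -- The second entry serves points farther apart than `h₁`, where the difference is at most `2 M`.
  set C' := max C (2 * M / h₁ ^ β) with hC'
  have hC'0 : 0 ≤ C' := le_max_of_le_right (by positivity)
  have key : ∀ s t, s < t → |f t - f s| ≤ C' * (t - s) ^ β := by
    intro s t hst
    have h0 : 0 ≤ (t - s) ^ β := Real.rpow_nonneg (by linarith) β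
    by_cases hle : t - s ≤ h₁
    · exact (hC s t hst hle).trans (mul_le_mul_of_nonneg_right (le_max_left _ _) h0)
    · have h2 : |f t - f s| ≤ 2 * M := by
        have := abs_sub (f t) (f s)
        linarith [hM t, hM s]
      calc |f t - f s| ≤ 2 * M := h2
        _ = 2 * M / h₁ ^ β * h₁ ^ β := by field_simp
        _ ≤ C' * (t - s) ^ β := by
          refine mul_le_mul (le_max_right _ _) ?_ hp.le hC'0
          exact Real.rpow_le_rpow hh.le (by linarith) hβ.le
  refine ⟨C', hC'0, fun s t => ?_⟩
  rcases lt_trichotomy s t with hst | rfl | hst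
  · rw [abs_sub_comm (f s), abs_sub_comm s, abs_of_pos (sub_pos.2 hst)]
    exact key s t hst
  · simp [Real.zero_rpow hβ.ne']
  · rw [abs_of_pos (sub_pos.2 hst)]
    exact key t s hst

lemma abs_floor_div_sub_le (t : ℝ) (l : ℕ) : |(⌊2 ^ l * t⌋ : ℝ) / 2 ^ l - t| ≤ 1 / 2 ^ l := by
  have h2 : (0 : ℝ) < 2 ^ l := by positivity
  have e : (⌊2 ^ l * t⌋ : ℝ) / 2 ^ l - t = (⌊2 ^ l * t⌋ - 2 ^ l * t) / 2 ^ l := by field_simp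
  rw [e, abs_div, abs_of_pos h2]
  gcongr
  rw [abs_le]
  constructor <;> linarith [Int.floor_le ((2 : ℝ) ^ l * t), Int.lt_floor_add_one ((2 : ℝ) ^ l * t)]

lemma tendsto_floor_div (t : ℝ) :
    Tendsto (fun l : ℕ => (⌊2 ^ l * t⌋ : ℝ) / 2 ^ l) atTop (𝓝 t) := by
  rw [tendsto_iff_norm_sub_tendsto_zero]
  refine squeeze_zero (fun _ => norm_nonneg _) (fun l => abs_floor_div_sub_le t l) ?_
  simpa using tendsto_pow_atTop_nhds_zero_of_lt_one (r := (1 / 2 : ℝ)) (by norm_num) (by norm_num)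

/-- The chain with the value `e` at position `2 m + 2` and zeros elsewhere. -/
def bumpChain (d m : ℕ) [NeZero d] : Fin (6 * m + 4) → Pt d :=
  fun i => if (i : ℕ) = 2 * m + 2 then unitVec d else 0

lemma extend_bumpChain (d m : ℕ) [NeZero d] :
    extend (bumpChain d m) = Pi.single ((2 * m + 2 : ℕ) : ℤ) (unitVec d) := by
  funext i
  by_cases h : i = ((2 * m + 2 : ℕ) : ℤ)
  · subst h
    rw [extend_of_mem _ (by omega) (by omega)]
    rw [Pi.single_eq_same, bumpChain, if_pos]
    rfl
  · rw [Pi.single_eq_of_ne h, extend]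
    split_ifs with h1
    · rw [bumpChain, if_neg]
      simp only
      omega
    · rfl

lemma iteratedDeriv_two {F : Type*} [NormedAddCommGroup F] [NormedSpace ℝ F] (f : ℝ → F) :
    iteratedDeriv 2 f = deriv (deriv f) := by
  rw [iteratedDeriv_succ, iteratedDeriv_one]

lemma ContDiffOn.hasDerivAt_two {F : Type*} [NormedAddCommGroup F] [NormedSpace ℝ F] {f : ℝ → F}
    {s : Set ℝ} (hs : IsOpen s) (hf : ContDiffOn ℝ 2 f s) :
    (∀ t ∈ s, HasDerivAt f (deriv f t) t) ∧ (∀ t ∈ s, HasDerivAt (deriv f) (deriv (deriv f) t) t) ∧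
      ContinuousOn (deriv (deriv f)) s := by
  have h2 : ContDiffOn ℝ (1 + 1) f s := by
    simpa [one_add_one_eq_two] using hf
  obtain ⟨d1, -, h1⟩ := (contDiffOn_succ_iff_deriv_of_isOpen hs).1 h2
  have h1' : ContDiffOn ℝ (0 + 1) (deriv f) s := by simpa using h1
  obtain ⟨d2, -, h0⟩ := (contDiffOn_succ_iff_deriv_of_isOpen hs).1 h1'
  exact ⟨fun t ht => (d1.differentiableAt (hs.mem_nhds ht)).hasDerivAt,
    fun t ht => (d2.differentiableAt (hs.mem_nhds ht)).hasDerivAt, h0.continuousOn⟩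

lemma hasDerivAt_coord {d : ℕ} {f : ℝ → Pt d} {f' : Pt d} {c t : ℝ} (i : Fin d)
    (h : HasDerivAt f f' (t + c)) : HasDerivAt (fun s => f (s + c) i) (f' i) t :=
  (EuclideanSpace.proj (𝕜 := ℝ) i).hasFDerivAt.comp_hasDerivAt t (h.comp_add_const t c)

/-- The basic limit function exists if the linear scheme is smooth at all chains. -/
lemma exists_isBasicLimit {d m : ℕ} [NeZero d] (a : Fin 2 → Fin (m + 1) → ℝ) {β : ℝ} (hβ : 0 < β)
    (h : IsHolderAt (linearRules d a) 2 β (bumpChain d m)) :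
    ∃ φ φ₁ φ₂ : ℝ → ℝ, IsBasicLimit a β φ φ₁ φ₂ := by
  obtain ⟨Φ, ⟨hΦc, hlim⟩, hcd, h₀, hh₀, hhol⟩ := h
  -- The bump sits at the midpoint `c = 2 m + 2` of the parameter interval. Recentred, this is `(-c,
  -- c)`, which exceeds the support bound `2 m + 1` by a margin of `1`. The first coordinate of the
  -- curve is the sought function.
  have hL : ((6 * m + 4 : ℕ) : ℝ) - 2 * m = 4 * m + 4 := by push_cast; ring
  rw [hL] at hlim hcd hhol
  set c : ℝ := 2 * m + 2 with hc
  set f : ℝ → ℝ := fun t => Φ (t + c) 0 with hf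
  set f₁ : ℝ → ℝ := fun t => deriv Φ (t + c) 0 with hf₁
  set f₂ : ℝ → ℝ := fun t => deriv (deriv Φ) (t + c) 0 with hf₂
  have hmem : ∀ t, |t| < c → t + c ∈ Set.Ioo (0 : ℝ) (4 * m + 4) := by
    intro t ht
    rw [abs_lt] at ht
    constructor <;> linarith
  obtain ⟨d1, d2, cont⟩ := ContDiffOn.hasDerivAt_two isOpen_Ioo hcd
  have D1 : ∀ t, |t| < c → HasDerivAt f (f₁ t) t := fun t ht => hasDerivAt_coord 0 (d1 _ (hmem t ht))
  have D2 : ∀ t, |t| < c → HasDerivAt f₁ (f₂ t) t := fun t ht => hasDerivAt_coord 0 (d2 _ (hmem t ht))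
  have C2 : ∀ t, |t| < c → ContinuousAt f₂ t := by
    intro t ht
    have h1 := (cont.continuousAt (isOpen_Ioo.mem_nhds (hmem t ht)))
    have h2 : ContinuousAt (fun s => deriv (deriv Φ) (s + c)) t :=
      ContinuousAt.comp (f := fun s => s + c) h1 (by fun_prop)
    exact (EuclideanSpace.proj (𝕜 := ℝ) 0).continuous.continuousAt.comp h2
  have approx : ∀ z : ℝ, 0 < z → ∀ ε : ℝ, 0 < ε → ∃ l₀ : ℕ, ∀ l : ℕ, l₀ ≤ l → ∀ k : ℤ,
      |(k : ℝ) / 2 ^ l| ≤ c - z → |f (k / 2 ^ l) - mask a l k| ≤ ε := by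
    intro z hz ε hε
    obtain ⟨l₀, H⟩ := hlim z hz ε hε
    refine ⟨l₀, fun l hl k hk => ?_⟩
    have h2 : (0 : ℝ) < 2 ^ l := by positivity
    rw [abs_le, le_div_iff₀ h2, div_le_iff₀ h2] at hk
    set j : ℤ := k + 2 ^ l * (2 * m + 2) with hj
    have hjr : (j : ℝ) = k + 2 ^ l * c := by rw [hj, hc]; push_cast; ring
    have hj0 : 0 ≤ j := by
      have : (0 : ℝ) ≤ j := by rw [hjr]; nlinarith
      exact_mod_cast this
    have hlen : ((len m (6 * m + 4) l : ℕ) : ℝ) = 2 ^ l * (4 * m + 4) + 2 * m := by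
      rw [len_eq (by omega)]
      have : 6 * m + 4 - 2 * m = 4 * m + 4 := by omega
      rw [this]
      push_cast
      ring
    have hj1 : j < len m (6 * m + 4) l := by
      have : (j : ℝ) < (len m (6 * m + 4) l : ℕ) := by
        rw [hjr, hlen]
        have hm0 : (0 : ℝ) ≤ m := by positivity
        nlinarith
      exact_mod_cast this
    have hjt : ((j.toNat : ℕ) : ℝ) = k + 2 ^ l * c := by
      rw [← hjr]
      exact_mod_cast Int.toNat_of_nonneg hj0
    have e : ((j.toNat : ℕ) : ℝ) / 2 ^ l = k / 2 ^ l + c := by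
      rw [hjt]
      field_simp
    have key := H l hl ⟨j.toNat, by omega⟩ (by
      simp only [hjt]
      rw [le_div_iff₀ h2]; nlinarith) (by
      simp only [hjt]
      rw [div_le_iff₀ h2]; nlinarith)
    simp only [e] at key
    rw [← extend_of_mem (iter (linearRules d a) (bumpChain d m) l) hj0 hj1, extend_iter_linearRules a _ l j hj0 hj1, extend_bumpChain,
      linearSub_pow_single] at key
    have ej : j - 2 ^ l * ((2 * m + 2 : ℕ) : ℤ) = k := by rw [hj]; push_cast; ring
    rw [ej] at key
    have := (PiLp.norm_apply_le (Φ (k / 2 ^ l + c) - mask a l k • unitVec d) 0).trans key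
    simpa [unitVec] using this
  -- The masks vanish at dyadic parameters beyond `2 m + 1`. Dyadic numbers tend to `t` and `f` is
  -- continuous.
  have hf0 : ∀ t, (2 * m + 1 : ℝ) < |t| → |t| < c → f t = 0 := by
    intro t h1 h2
    have hfc : ContinuousAt f t := (D1 t h2).continuousAt
    have T := tendsto_floor_div t
    have T1 := hfc.tendsto.comp T
    set z := (c - |t|) / 2 with hz
    have hz0 : 0 < z := by rw [hz]; linarith
    refine tendsto_nhds_unique T1 ?_
    rw [Metric.tendsto_atTop]
    intro ε hε
    obtain ⟨l₀, H⟩ := approx z hz0 (ε / 2) (by positivity)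
    obtain ⟨l₁, H1⟩ := eventually_atTop.1 (T.eventually (eventually_lt_abs h1))
    obtain ⟨l₂, H2⟩ := eventually_atTop.1 (T.eventually
      (eventually_abs_lt (show |t| < c - z by rw [hz]; linarith)))
    refine ⟨max l₀ (max l₁ l₂), fun l hl => ?_⟩
    have k1 := H l (by omega) ⌊2 ^ l * t⌋ (H2 l (by omega)).le
    have k2 := H1 l (by omega)
    have hmask : mask a l ⌊2 ^ l * t⌋ = 0 := by
      apply mask_eq_zero
      have h2 : (0 : ℝ) < 2 ^ l := by positivity
      rw [lt_abs] at k2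
      have hm0 : (0 : ℝ) ≤ m := by positivity
      rcases k2 with k2 | k2
      · left
        rw [lt_div_iff₀ h2] at k2
        have : ((2 ^ l : ℤ) : ℝ) ≤ ⌊2 ^ l * t⌋ := by push_cast; nlinarith
        exact_mod_cast this
      · right
        rw [← neg_div, lt_div_iff₀ h2] at k2
        have : ((⌊2 ^ l * t⌋ + 2 * m * 2 ^ l : ℤ) : ℝ) < 0 := by push_cast; nlinarith
        exact_mod_cast this
    rw [hmask, sub_zero] at k1
    rw [Real.dist_eq, sub_zero]
    exact k1.trans_lt (by linarith)
  have hr : (2 * m + 1 : ℝ) < c := by rw [hc]; linarith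
  have hf1 := deriv_eq_zero_of_annulus D1 hf0
  have hf2 := deriv_eq_zero_of_annulus D2 hf1
  have hz2 : ∀ t, (2 * m + 1 : ℝ) < |t| → cutoff c f₂ t = 0 := fun t ht => cutoff_eq_zero hf2 ht
  refine ⟨cutoff c f, cutoff c f₁, cutoff c f₂, ⟨fun t ht => cutoff_eq_zero hf0 ht,
    fun t ht => cutoff_eq_zero hf1 ht, hz2, hasDerivAt_cutoff hr D1 hf0,
    hasDerivAt_cutoff hr D2 hf1, ?_, ?_⟩⟩
  · obtain ⟨C, hC⟩ := hhol (1 / 2) (by norm_num)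
    refine exists_holder_of_local (h₁ := min h₀ (1 / 2)) (C := max C 0)
      (continuous_cutoff hr C2 hf2) hz2 (by positivity) hβ fun s t hst hle => ?_
    have hle1 : t - s ≤ h₀ := hle.trans (min_le_left _ _)
    have hle2 : t - s ≤ 1 / 2 := hle.trans (min_le_right _ _)
    have hp : 0 ≤ (t - s) ^ β := Real.rpow_nonneg (by linarith) β
    have hzero : cutoff c f₂ t = 0 → cutoff c f₂ s = 0 →
        |cutoff c f₂ t - cutoff c f₂ s| ≤ max C 0 * (t - s) ^ β := by
      intro h1 h2
      rw [h1, h2, sub_zero, abs_zero]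
      exact mul_nonneg (le_max_right _ _) hp
    by_cases ht : 2 * m + 3 / 2 < t
    · exact hzero (hz2 t (lt_abs.2 (Or.inl (by linarith)))) (hz2 s (lt_abs.2 (Or.inl (by linarith))))
    by_cases hs : s < -(2 * m + 3 / 2)
    · exact hzero (hz2 t (lt_abs.2 (Or.inr (by linarith)))) (hz2 s (lt_abs.2 (Or.inr (by linarith))))
    push Not at ht hs
    rw [cutoff_of_lt (abs_lt.2 ⟨by linarith, by linarith⟩),
      cutoff_of_lt (abs_lt.2 ⟨by linarith, by linarith⟩)]
    have key := hC (t - s) (by linarith) hle1 ((s + t) / 2 + c)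
      ⟨by linarith, by linarith⟩
    have e1 : (s + t) / 2 + c + (t - s) / 2 = t + c := by ring
    have e2 : (s + t) / 2 + c - (t - s) / 2 = s + c := by ring
    rw [e1, e2, iteratedDeriv_two] at key
    have := (PiLp.norm_apply_le (deriv (deriv Φ) (t + c) - deriv (deriv Φ) (s + c)) 0).trans key
    refine le_trans ?_ (this.trans (mul_le_mul_of_nonneg_right (le_max_left _ _) hp))
    simp [hf₂]
  · intro ε hε
    obtain ⟨l₀, H⟩ := approx (1 / 2) (by norm_num) ε hε
    refine ⟨l₀, fun l hl i => ?_⟩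
    by_cases hi : |(i : ℝ) / 2 ^ l| ≤ c - 1 / 2
    · rw [cutoff_of_lt (hi.trans_lt (by linarith)), abs_sub_comm]
      exact H l hl i hi
    · push Not at hi
      rw [cutoff_eq_zero hf0 (show (2 * m + 1 : ℝ) < _ by linarith), sub_zero, mask_eq_zero]
      · simpa using hε.le
      · have h2 : (0 : ℝ) < 2 ^ l := by positivity
        have hm0 : (0 : ℝ) ≤ m := by positivity
        rw [lt_abs] at hi
        rcases hi with k2 | k2
        · left
          rw [lt_div_iff₀ h2] at k2
          have : ((2 ^ l : ℤ) : ℝ) ≤ i := by push_cast; nlinarith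
          exact_mod_cast this
        · right
          rw [← neg_div, lt_div_iff₀ h2] at k2
          have : ((i + 2 * m * 2 ^ l : ℤ) : ℝ) < 0 := by push_cast; nlinarith
          exact_mod_cast this

/-! ### Limit curves of bi-infinite sequences -/

section Curve

variable {E : Type*} [NormedAddCommGroup E] [NormedSpace ℝ E] {m : ℕ}

/-- The combination of the integer translates of `φ` with coefficients `q`. -/
def curve (φ : ℝ → ℝ) (q : ℤ → E) (t : ℝ) : E := ∑ᶠ j : ℤ, φ (t - j) • q j

/-- Contains all integers at distance at most `2 m + 1` from `t`. -/
def indexSet (m : ℕ) (t : ℝ) : Finset ℤ := Finset.Icc (⌊t⌋ - (2 * m + 1)) (⌊t⌋ + (2 * m + 2))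

lemma card_indexSet (m : ℕ) (t : ℝ) : (indexSet m t).card = 4 * m + 4 := by
  rw [indexSet, Int.card_Icc]
  omega

lemma lt_abs_of_notMem_indexSet {t : ℝ} {j : ℤ} (h : j ∉ indexSet m t) :
    2 * m + 1 < |t - j| := by
  by_contra hc
  rw [not_lt, abs_le] at hc
  apply h
  have h1 := Int.floor_le t
  have h2 := Int.lt_floor_add_one t
  rw [indexSet, Finset.mem_Icc]
  constructor
  · have : ((⌊t⌋ - (2 * m + 1) : ℤ) : ℝ) ≤ j := by push_cast; linarith
    exact_mod_cast this
  · have : (j : ℝ) < ((⌊t⌋ + (2 * m + 2) : ℤ) : ℝ) := by push_cast; linarith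
    exact (by exact_mod_cast this : j < ⌊t⌋ + (2 * m + 2)).le

lemma norm_finsum_le {E : Type*} [NormedAddCommGroup E] {F : ℤ → E} {s : Finset ℤ} {B : ℝ} (hs : ∀ j, j ∉ s → F j = 0)
    (hB : ∀ j, ‖F j‖ ≤ B) : ‖∑ᶠ j, F j‖ ≤ s.card * B := by
  rw [finsum_eq_sum_of_support_subset (s := s)]
  · refine (norm_sum_le _ _).trans ((Finset.sum_le_card_nsmul _ _ B fun j _ => hB j).trans ?_)
    rw [nsmul_eq_mul]
  · intro j hj
    by_contra h
    exact hj (hs j h)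

lemma finite_support {E : Type*} [NormedAddCommGroup E] {F : ℤ → E} {s : Finset ℤ} (hs : ∀ j, j ∉ s → F j = 0) :
    F.support.Finite :=
  s.finite_toSet.subset fun j hj => by
    by_contra h
    exact hj (hs j h)

variable {φ : ℝ → ℝ}

lemma curve_term_eq_zero (hφ : ∀ t : ℝ, 2 * m + 1 < |t| → φ t = 0)
    (q : ℤ → E) {t : ℝ} {j : ℤ} (h : j ∉ indexSet m t) :
    φ (t - j) • q j = 0 := by
  rw [hφ _ (lt_abs_of_notMem_indexSet h), zero_smul]

lemma curve_eq_sum (hφ : ∀ t : ℝ, 2 * m + 1 < |t| → φ t = 0)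
    (q : ℤ → E) (t : ℝ) :
    curve φ q t = ∑ j ∈ indexSet m t, φ (t - j) • q j :=
  finsum_eq_sum_of_support_subset _ fun j hj => by
    by_contra h
    exact hj (curve_term_eq_zero hφ q h)

lemma norm_curve_le (hφ : ∀ t : ℝ, 2 * m + 1 < |t| → φ t = 0)
    {M B : ℝ} (hM : ∀ t, |φ t| ≤ M) {q : ℤ → E} (hq : ∀ j, ‖q j‖ ≤ B) (t : ℝ) :
    ‖curve φ q t‖ ≤ (4 * m + 4) * (M * B) := by
  have hM0 : 0 ≤ M := (abs_nonneg _).trans (hM 0)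
  have := norm_finsum_le (B := M * B) (fun j hj => curve_term_eq_zero hφ q (t := t) hj) fun j => by
    rw [norm_smul]
    exact mul_le_mul (hM _) (hq j) (norm_nonneg _) hM0
  rw [card_indexSet] at this
  exact_mod_cast this

/-- The difference is one sum over the union of two index sets of `4 m + 4` elements each. Second
differences involve three such sets. -/
lemma norm_curve_sub_le (hφ : ∀ t : ℝ, 2 * m + 1 < |t| → φ t = 0)
    {B δ x y : ℝ} (hδ : ∀ j : ℤ, |φ (x - j) - φ (y - j)| ≤ δ) {q : ℤ → E}
    (hq : ∀ j, ‖q j‖ ≤ B) : ‖curve φ q x - curve φ q y‖ ≤ (8 * m + 8) * (δ * B) := by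
  have hδ0 : 0 ≤ δ := (abs_nonneg _).trans (hδ 0)
  have hB0 : 0 ≤ B := (norm_nonneg _).trans (hq 0)
  have hx := fun j (hj : j ∉ indexSet m x) => curve_term_eq_zero hφ q hj
  have hy := fun j (hj : j ∉ indexSet m y) => curve_term_eq_zero hφ q hj
  rw [curve, curve, ← finsum_sub_distrib (finite_support hx) (finite_support hy)]
  have := norm_finsum_le (B := δ * B) (s := indexSet m x ∪ indexSet m y)
    (F := fun j : ℤ => φ (x - j) • q j - φ (y - j) • q j)
    (fun j hj => by
      rw [Finset.mem_union, not_or] at hj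
      rw [hx j hj.1, hy j hj.2, sub_zero]) fun j => by
    rw [← sub_smul, norm_smul]
    exact mul_le_mul (hδ j) (hq j) (norm_nonneg _) hδ0
  refine this.trans (mul_le_mul_of_nonneg_right ?_ (mul_nonneg hδ0 hB0))
  have hc := Finset.card_union_le (indexSet m x) (indexSet m y)
  rw [card_indexSet, card_indexSet] at hc
  have : ((indexSet m x ∪ indexSet m y).card : ℝ) ≤ ((4 * m + 4 + (4 * m + 4) : ℕ) : ℝ) := by
    exact_mod_cast hc
  refine this.trans (le_of_eq ?_)
  push_cast
  ring

lemma norm_curve_second_diff_le (hφ : ∀ t : ℝ, 2 * m + 1 < |t| → φ t = 0)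
    {B δ x y z : ℝ}
    (hδ : ∀ j : ℤ, |φ (z - j) - φ (y - j) - (φ (y - j) - φ (x - j))| ≤ δ) {q : ℤ → E}
    (hq : ∀ j, ‖q j‖ ≤ B) :
    ‖curve φ q z - curve φ q y - (curve φ q y - curve φ q x)‖ ≤ (12 * m + 12) * (δ * B) := by
  have hδ0 : 0 ≤ δ := (abs_nonneg _).trans (hδ 0)
  have hB0 : 0 ≤ B := (norm_nonneg _).trans (hq 0)
  have hx := fun j (hj : j ∉ indexSet m x) => curve_term_eq_zero hφ q hj
  have hy := fun j (hj : j ∉ indexSet m y) => curve_term_eq_zero hφ q hj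
  have hz := fun j (hj : j ∉ indexSet m z) => curve_term_eq_zero hφ q hj
  have hzy : ∀ j ∉ indexSet m z ∪ indexSet m y, φ (z - j) • q j - φ (y - j) • q j = 0 :=
    fun j hj => by
      rw [Finset.mem_union, not_or] at hj
      rw [hz j hj.1, hy j hj.2, sub_zero]
  have hyx : ∀ j ∉ indexSet m y ∪ indexSet m x, φ (y - j) • q j - φ (x - j) • q j = 0 :=
    fun j hj => by
      rw [Finset.mem_union, not_or] at hj
      rw [hy j hj.1, hx j hj.2, sub_zero]
  rw [curve, curve, curve, ← finsum_sub_distrib (finite_support hy) (finite_support hx),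
    ← finsum_sub_distrib (finite_support hz) (finite_support hy),
    ← finsum_sub_distrib (finite_support hzy) (finite_support hyx)]
  have := norm_finsum_le (B := δ * B) (s := (indexSet m z ∪ indexSet m y) ∪ indexSet m x)
    (F := fun j : ℤ => φ (z - j) • q j - φ (y - j) • q j - (φ (y - j) • q j - φ (x - j) • q j))
    (fun j hj => by
      simp only [Finset.mem_union, not_or] at hj
      rw [hx j hj.2, hy j hj.1.2, hz j hj.1.1]
      simp) fun j => by
    rw [← sub_smul, ← sub_smul, ← sub_smul, norm_smul]
    exact mul_le_mul (hδ j) (hq j) (norm_nonneg _) hδ0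
  refine this.trans (mul_le_mul_of_nonneg_right ?_ (mul_nonneg hδ0 hB0))
  have hc := Finset.card_union_le (indexSet m z ∪ indexSet m y) (indexSet m x)
  have hc2 := Finset.card_union_le (indexSet m z) (indexSet m y)
  rw [card_indexSet] at hc
  rw [card_indexSet, card_indexSet] at hc2
  have : (((indexSet m z ∪ indexSet m y) ∪ indexSet m x).card : ℝ) ≤ ((12 * m + 12 : ℕ) : ℝ) := by
    exact_mod_cast (by omega)
  exact_mod_cast this

lemma curve_add (hφ : ∀ t : ℝ, 2 * m + 1 < |t| → φ t = 0)
    (p q : ℤ → E) (t : ℝ) :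
    curve φ (p + q) t = curve φ p t + curve φ q t := by
  simp only [curve_eq_sum hφ, Pi.add_apply, smul_add, Finset.sum_add_distrib]

lemma curve_sub (hφ : ∀ t : ℝ, 2 * m + 1 < |t| → φ t = 0)
    (p q : ℤ → E) (t : ℝ) :
    curve φ (p - q) t = curve φ p t - curve φ q t := by
  simp only [curve_eq_sum hφ, Pi.sub_apply, smul_sub, Finset.sum_sub_distrib]

lemma curve_smul (hφ : ∀ t : ℝ, 2 * m + 1 < |t| → φ t = 0)
    (c : ℝ) (q : ℤ → E) (t : ℝ) : curve φ (c • q) t = c • curve φ q t := by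
  simp only [curve_eq_sum hφ, Pi.smul_apply, smul_comm _ c, Finset.smul_sum]

lemma curve_shift (q : ℤ → E) (c : ℤ) (t : ℝ) :
    curve φ (fun j => q (j + c)) t = curve φ q (t + c) := by
  refine Eq.trans ?_ (finsum_comp_equiv (Equiv.addRight c) (f := fun j : ℤ => φ (t + c - j) • q j))
  refine finsum_congr fun j => ?_
  simp only [Equiv.coe_addRight]
  congr 2
  push_cast
  ring

end Curve

/-! ### Bounds for linear schemes with a basic limit function -/

section BasicLimit

variable {E : Type*} [NormedAddCommGroup E] [NormedSpace ℝ E] {m : ℕ}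
  {a : Fin 2 → Fin (m + 1) → ℝ} {β : ℝ} {φ φ₁ φ₂ : ℝ → ℝ}

lemma IsBasicLimit.continuous (h : IsBasicLimit a β φ φ₁ φ₂) : Continuous φ :=
  continuous_iff_continuousAt.2 fun t => (h.hasDerivAt t).continuousAt

lemma IsBasicLimit.continuous₁ (h : IsBasicLimit a β φ φ₁ φ₂) : Continuous φ₁ :=
  continuous_iff_continuousAt.2 fun t => (h.hasDerivAt₁ t).continuousAt

lemma IsBasicLimit.continuous₂ (h : IsBasicLimit a β φ φ₁ φ₂) (hβ : 0 < β) : Continuous φ₂ := by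
  obtain ⟨C, -, hC⟩ := h.holder
  refine continuous_iff_continuousAt.2 fun t => tendsto_iff_norm_sub_tendsto_zero.2 ?_
  refine squeeze_zero (fun _ => norm_nonneg _) (fun s => hC s t) ?_
  have : ContinuousAt (fun s => C * |s - t| ^ β) t := by
    refine continuousAt_const.mul (ContinuousAt.rpow_const (by fun_prop) (Or.inr hβ.le))
  have h2 := this.tendsto
  simpa [Real.zero_rpow hβ.ne'] using h2

lemma abs_sub_le_of_hasDerivAt {f f' : ℝ → ℝ} {M : ℝ} (hf : ∀ t, HasDerivAt f (f' t) t)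
    (hM : ∀ t, |f' t| ≤ M) (x y : ℝ) : |f x - f y| ≤ M * |x - y| :=
  Convex.norm_image_sub_le_of_norm_hasDerivWithin_le (s := Set.univ)
    (fun t _ => (hf t).hasDerivWithinAt) (fun t _ => hM t) convex_univ trivial trivial

/-- Second differences of a function with bounded second derivative. -/
lemma abs_second_diff_le {f f' f'' : ℝ → ℝ} {M : ℝ} (hf : ∀ t, HasDerivAt f (f' t) t)
    (hf' : ∀ t, HasDerivAt f' (f'' t) t) (hM : ∀ t, |f'' t| ≤ M) (x h : ℝ) :
    |f (x + h + h) - f (x + h) - (f (x + h) - f x)| ≤ M * h ^ 2 := by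
  have hd : ∀ t, HasDerivAt (fun s => f (s + h) - f s) (f' (t + h) - f' t) t :=
    fun t => ((hf (t + h)).comp_add_const t h).sub (hf t)
  have := abs_sub_le_of_hasDerivAt hd (M := M * |h|) (fun t => by
    simpa using abs_sub_le_of_hasDerivAt hf' hM (t + h) t) (x + h) x
  refine this.trans (le_of_eq ?_)
  rw [add_sub_cancel_left, mul_assoc, abs_mul_abs_self]
  ring

/-- Both sides are sums over the same `4 m + 4` indices, and masks approximate `φ` uniformly. Hence
`l₀` depends neither on `q` nor on `i`. -/
lemma linearSub_pow_sub_curve_le (h : IsBasicLimit a β φ φ₁ φ₂) {ε : ℝ} (hε : 0 < ε) :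
    ∃ l₀ : ℕ, ∀ l, l₀ ≤ l → ∀ (q : ℤ → E) (B : ℝ), (∀ j, ‖q j‖ ≤ B) → ∀ i : ℤ,
      ‖(linearSub E a ^ l) q i - curve φ q (i / 2 ^ l)‖ ≤ ε * B := by
  obtain ⟨l₀, H⟩ := h.limit (ε / (4 * m + 4)) (by positivity)
  refine ⟨l₀, fun l hl q B hq i => ?_⟩
  have h2 : (0 : ℝ) < 2 ^ l := by positivity
  have e : ∀ j : ℤ, ((i - 2 ^ l * j : ℤ) : ℝ) / 2 ^ l = i / 2 ^ l - j := by
    intro j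
    push_cast
    field_simp
  have h3 : ∀ j ∉ indexSet m ((i : ℝ) / 2 ^ l), mask a l (i - 2 ^ l * j) • q j = 0 := by
    intro j hj
    have := lt_abs_of_notMem_indexSet hj
    rw [← e, lt_abs] at this
    rw [mask_eq_zero, zero_smul]
    have hm0 : (0 : ℝ) ≤ m := by positivity
    rcases this with k2 | k2
    · left
      rw [lt_div_iff₀ h2] at k2
      have : ((2 ^ l : ℤ) : ℝ) ≤ (i - 2 ^ l * j : ℤ) := by
        rw [Int.cast_pow, Int.cast_ofNat]; nlinarith
      exact_mod_cast this
    · right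
      rw [← neg_div, lt_div_iff₀ h2] at k2
      have : ((i - 2 ^ l * j + 2 * m * 2 ^ l : ℤ) : ℝ) < 0 := by
        rw [Int.cast_add]
        have : ((2 * m * 2 ^ l : ℤ) : ℝ) = 2 * m * 2 ^ l := by push_cast; ring
        rw [this]
        nlinarith
      exact_mod_cast this
  have h4 := fun j (hj : j ∉ indexSet m ((i : ℝ) / 2 ^ l)) => curve_term_eq_zero h.support q hj
  rw [linearSub_pow_eq_finsum, curve, ← finsum_sub_distrib (finite_support h3) (finite_support h4)]
  have := norm_finsum_le (B := ε / (4 * m + 4) * B) (s := indexSet m ((i : ℝ) / 2 ^ l))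
    (F := fun j : ℤ => mask a l (i - 2 ^ l * j) • q j - φ (i / 2 ^ l - j) • q j)
    (fun j hj => by rw [h3 j hj, h4 j hj, sub_zero]) fun j => by
      rw [← sub_smul, norm_smul, ← e]
      exact mul_le_mul (H l hl _) (hq j) (norm_nonneg _) (by positivity)
  refine this.trans (le_of_eq ?_)
  rw [card_indexSet]
  push_cast
  field_simp

lemma norm_linearSub_le_of_local (a : Fin 2 → Fin (m + 1) → ℝ) {q : ℤ → E} {B : ℝ} {i : ℤ}
    (hB0 : 0 ≤ B) (hq : ∀ j : ℕ, j ≤ m → ‖q (i / 2 + j)‖ ≤ B) :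
    ‖linearSub E a q i‖ ≤ (1 + ∑ s, ∑ j, |a s j|) * B := by
  rw [linearSub_apply]
  calc ‖∑ j, a (parity i) j • q (i / 2 + (j : ℕ))‖ ≤ ∑ j, |a (parity i) j| * B := by
        refine (norm_sum_le _ _).trans (Finset.sum_le_sum fun j _ => ?_)
        rw [norm_smul]
        exact mul_le_mul_of_nonneg_left (hq _ (Nat.lt_succ_iff.1 j.2)) (abs_nonneg _)
    _ = (∑ j, |a (parity i) j|) * B := by rw [Finset.sum_mul]
    _ ≤ _ := by
      refine mul_le_mul_of_nonneg_right ?_ hB0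
      have := Finset.single_le_sum (f := fun s => ∑ j, |a s j|) (s := Finset.univ)
        (fun s _ => Finset.sum_nonneg fun j _ => abs_nonneg _) (Finset.mem_univ (parity i))
      linarith

lemma norm_linearSub_le (a : Fin 2 → Fin (m + 1) → ℝ) {q : ℤ → E} {B : ℝ}
    (hq : ∀ j, ‖q j‖ ≤ B) (i : ℤ) :
    ‖linearSub E a q i‖ ≤ (1 + ∑ s, ∑ j, |a s j|) * B :=
  norm_linearSub_le_of_local a ((norm_nonneg _).trans (hq 0)) fun _ _ => hq _

/-- The iterates of a linear scheme with a basic limit function are uniformly bounded. -/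
lemma exists_norm_linearSub_pow_le (E : Type*) [NormedAddCommGroup E] [NormedSpace ℝ E]
    (h : IsBasicLimit a β φ φ₁ φ₂) :
    ∃ K, 0 < K ∧ ∀ (l : ℕ) (q : ℤ → E) (B : ℝ), (∀ j, ‖q j‖ ≤ B) → ∀ i : ℤ,
      ‖(linearSub E a ^ l) q i‖ ≤ K * B := by
  obtain ⟨M, hM0, hM⟩ := exists_bound_of_support h.continuous h.support
  obtain ⟨l₀, H⟩ := linearSub_pow_sub_curve_le (E := E) h one_pos
  set S : ℝ := 1 + ∑ s, ∑ j, |a s j| with hS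
  have hS1 : 1 ≤ S := by
    have : 0 ≤ ∑ s, ∑ j, |a s j| :=
      Finset.sum_nonneg fun s _ => Finset.sum_nonneg fun j _ => abs_nonneg _
    linarith
  -- Each of the first `l₀` levels costs a factor of at most `S`; later levels are compared with the
  -- bounded limit curve.
  refine ⟨max (S ^ l₀) (1 + (4 * m + 4) * M), by positivity, fun l q B hq i => ?_⟩
  have hB0 : 0 ≤ B := (norm_nonneg _).trans (hq 0)
  rcases le_total l₀ l with hl | hl
  · have h1 := H l hl q B hq i
    have h2 := norm_curve_le h.support hM hq (i / 2 ^ l)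
    have h3 := norm_sub_norm_le ((linearSub E a ^ l) q i) (curve φ q (i / 2 ^ l))
    calc ‖(linearSub E a ^ l) q i‖ ≤ (1 + (4 * m + 4) * M) * B := by linarith
      _ ≤ _ := mul_le_mul_of_nonneg_right (le_max_right _ _) hB0
  · have h1 : ∀ l, ∀ i, ‖(linearSub E a ^ l) q i‖ ≤ S ^ l * B := by
      intro l
      induction l with
      | zero => intro i; simpa using hq i
      | succ l ih =>
        intro i
        rw [linearSub_pow_succ', pow_succ', mul_assoc]
        exact norm_linearSub_le a ih i
    refine (h1 l i).trans (mul_le_mul_of_nonneg_right ?_ hB0)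
    exact (pow_le_pow_right₀ hS1 hl).trans (le_max_left _ _)

lemma exists_norm_curve_sub_le (E : Type*) [NormedAddCommGroup E] [NormedSpace ℝ E]
    (h : IsBasicLimit a β φ φ₁ φ₂) :
    ∃ C, 0 < C ∧ ∀ (q : ℤ → E) (B : ℝ), (∀ j, ‖q j‖ ≤ B) → ∀ x y,
      ‖curve φ q x - curve φ q y‖ ≤ C * B * |x - y| := by
  obtain ⟨M, hM0, hM⟩ := exists_bound_of_support h.continuous₁ h.support₁
  refine ⟨(8 * m + 8) * M, by positivity, fun q B hq x y => ?_⟩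
  have := norm_curve_sub_le (δ := M * |x - y|) (x := x) (y := y) h.support (fun j => by
    simpa using abs_sub_le_of_hasDerivAt h.hasDerivAt hM (x - j) (y - j)) hq
  refine this.trans (le_of_eq ?_)
  ring

/-- The limit curve is unchanged by subdivision, up to the parametrization. -/
lemma curve_linearSub (h : IsBasicLimit a β φ φ₁ φ₂) {q : ℤ → E} {B : ℝ} (hq : ∀ j, ‖q j‖ ≤ B)
    (t : ℝ) : curve φ (linearSub E a q) (2 * t) = curve φ q t := by
  obtain ⟨C, hC0, hC⟩ := exists_norm_curve_sub_le E h
  have hB0 : 0 ≤ B := (norm_nonneg _).trans (hq 0)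
  set S : ℝ := 1 + ∑ s, ∑ j, |a s j| with hS
  have hq' := norm_linearSub_le a hq
  have hB0' : 0 ≤ S * B := (norm_nonneg _).trans (hq' 0)
  rw [← sub_eq_zero, ← norm_le_zero_iff]
  refine le_of_forall_pos_le_add fun η hη => ?_
  set D : ℝ := 2 * C * (S * B) + S * B + B + C * B + 1 with hD
  have hD0 : 0 < D := by positivity
  set ε : ℝ := η / D with hε
  have hε0 : 0 < ε := by positivity
  obtain ⟨l₀, H⟩ := linearSub_pow_sub_curve_le (E := E) h hε0
  obtain ⟨l₁, H1⟩ := exists_pow_lt_of_lt_one hε0 (show (1 / 2 : ℝ) < 1 by norm_num)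
  set l := max l₀ l₁ with hl
  have hpow : (1 : ℝ) / 2 ^ (l + 1) ≤ ε := by
    have : (1 / 2 : ℝ) ^ (l + 1) ≤ (1 / 2) ^ l₁ :=
      pow_le_pow_of_le_one (by norm_num) (by norm_num) (by omega)
    rw [one_div_pow] at this
    linarith
  -- The same point is an iterate of `q` at parameter `s` and of the refined data at parameter `2
  -- s`, so both curves are close to it. `D` collects the coefficients of the four errors.
  set i : ℤ := ⌊2 ^ (l + 1) * t⌋ with hi
  set s : ℝ := i / 2 ^ (l + 1) with hs
  have hst : |s - t| ≤ ε := (abs_floor_div_sub_le t (l + 1)).trans hpow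
  have e1 := hC (linearSub E a q) (S * B) hq' (2 * t) (2 * s)
  have e2 := H l (le_max_left _ _) (linearSub E a q) (S * B) hq' i
  have e3 := H (l + 1) (by omega) q B hq i
  have e4 := hC q B hq s t
  have hs2 : (i : ℝ) / 2 ^ l = 2 * s := by rw [hs, pow_succ]; field_simp
  rw [hs2] at e2
  rw [linearSub_pow_succ] at e3
  have habs : |2 * t - 2 * s| = 2 * |s - t| := by
    rw [← mul_sub, abs_mul, abs_sub_comm]
    norm_num
  rw [habs] at e1
  have e1' : ‖curve φ (linearSub E a q) (2 * t) - curve φ (linearSub E a q) (2 * s)‖ ≤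
      2 * C * (S * B) * ε := by
    refine e1.trans ?_
    have := mul_le_mul_of_nonneg_left hst (show 0 ≤ 2 * (C * (S * B)) by positivity)
    linarith
  have e4' : ‖curve φ q s - curve φ q t‖ ≤ C * B * ε :=
    e4.trans (mul_le_mul_of_nonneg_left hst (by positivity))
  rw [norm_sub_rev] at e2
  have tri : curve φ (linearSub E a q) (2 * t) - curve φ q t =
      (curve φ (linearSub E a q) (2 * t) - curve φ (linearSub E a q) (2 * s)) +
      (curve φ (linearSub E a q) (2 * s) - (linearSub E a ^ l) (linearSub E a q) i) +
      ((linearSub E a ^ l) (linearSub E a q) i - curve φ q s) + (curve φ q s - curve φ q t) := by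
    abel
  rw [tri, zero_add]
  have hηD : D * ε = η := by rw [hε]; field_simp
  calc _ ≤ 2 * C * (S * B) * ε + ε * (S * B) + ε * B + C * B * ε :=
        (norm_add_le _ _).trans (add_le_add ((norm_add_le _ _).trans (add_le_add
          ((norm_add_le _ _).trans (add_le_add e1' e2)) e3)) e4')
    _ ≤ η := by
      rw [← hηD, hD]
      linarith

lemma curve_linearSub_pow (h : IsBasicLimit a β φ φ₁ φ₂) (l : ℕ) :
    ∀ {q : ℤ → E} {B : ℝ}, (∀ j, ‖q j‖ ≤ B) → ∀ t : ℝ,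
      curve φ ((linearSub E a ^ l) q) t = curve φ q (t / 2 ^ l) := by
  induction l with
  | zero => intro q B _ t; simp
  | succ l ih =>
    intro q B hq t
    rw [linearSub_pow_succ, ih (norm_linearSub_le a hq) t, ← curve_linearSub h hq, pow_succ]
    congr 1
    field_simp

end BasicLimit

/-! ### Stability -/

section Stability

variable {d m : ℕ} {a : Fin 2 → Fin (m + 1) → ℝ} {β : ℝ} {φ φ₁ φ₂ : ℝ → ℝ}

lemma linearSub_pow_const {E : Type*} [AddCommGroup E] [Module ℝ E]
    {m : ℕ} {a : Fin 2 → Fin (m + 1) → ℝ} (ha : ∀ s, ∑ j, a s j = 1) (v : E) (l : ℕ) :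
    (linearSub E a ^ l) (fun _ => v) = fun _ => v := by
  induction l with
  | zero => rfl
  | succ l ih =>
    rw [linearSub_pow_succ', ih]
    funext k
    rw [linearSub_apply, ← Finset.sum_smul, ha, one_smul]

/-- The integer translates of the basic limit function are linearly independent. -/
lemma eq_zero_of_curve_eq_zero (h : IsBasicLimit a β φ φ₁ φ₂) (ha : ∀ s, ∑ j, a s j = 1)
    (hnd : IsNondegenerate (linearRules d a)) {q : ℤ → Pt d} {B : ℝ} (hq : ∀ j, ‖q j‖ ≤ B)
    (h0 : ∀ t, curve φ q t = 0) : q = 0 := by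
  have hB0 : 0 ≤ B := (norm_nonneg _).trans (hq 0)
  have lim : ∀ ε : ℝ, 0 < ε → ∃ l₀ : ℕ, ∀ l : ℕ, l₀ ≤ l → ∀ i : ℤ,
      ‖(linearSub (Pt d) a ^ l) q i‖ ≤ ε := by
    intro ε hε
    obtain ⟨l₀, H⟩ := linearSub_pow_sub_curve_le (E := Pt d) h (ε := ε / (B + 1)) (by positivity)
    refine ⟨l₀, fun l hl i => ?_⟩
    have := H l hl q B hq i
    rw [h0, sub_zero] at this
    refine this.trans ?_
    rw [div_mul_eq_mul_div, div_le_iff₀ (by positivity)]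
    nlinarith
  have hconst := hnd q 0 fun r _ ε hε => by
    obtain ⟨l₀, H⟩ := lim ε hε
    refine ⟨l₀, fun l hl i _ => ?_⟩
    rw [iterate_subdivideZ_linearRules, zero_sub, norm_neg]
    exact H l hl i
  have hq0 : q = fun _ => q 0 := funext fun j => hconst j 0
  -- A constant sequence is reproduced at every level, so it can tend to zero only if it is zero.
  have : q 0 = 0 := by
    rw [← norm_le_zero_iff]
    refine le_of_forall_pos_le_add fun ε hε => ?_
    obtain ⟨l₀, H⟩ := lim ε hε
    have := H l₀ le_rfl 0
    rw [hq0, linearSub_pow_const ha] at this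
    simpa using this
  rw [hq0, this]
  rfl

/-- Compactness: the admissible sequences form a compact set in the product topology, and each curve
value is a finite sum, hence continuous in `q`. By linear independence the increasing open sets `U
k` cover this set, so a single `k` suffices. -/
lemma exists_lt_norm_curve (h : IsBasicLimit a β φ φ₁ φ₂) (ha : ∀ s, ∑ j, a s j = 1)
    (hnd : IsNondegenerate (linearRules d a)) :
    ∃ ε : ℝ, 0 < ε ∧ ∀ q : ℤ → Pt d, (∀ j, ‖q j‖ ≤ 1) → 1 / 2 ≤ ‖q 0‖ →
      ∃ t, ε < ‖curve φ q t‖ := by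
  set K : Set (ℤ → Pt d) :=
    Set.pi Set.univ (fun _ => Metric.closedBall 0 1) ∩ {q | 1 / 2 ≤ ‖q 0‖} with hK
  have hKc : IsCompact K :=
    (isCompact_univ_pi fun _ => isCompact_closedBall 0 1).inter_right
      (isClosed_le continuous_const (continuous_apply 0).norm)
  have hcont : ∀ t, Continuous fun q : ℤ → Pt d => curve φ q t := by
    intro t
    simp only [curve_eq_sum h.support]
    exact continuous_finsetSum _ fun j _ =>
      (show Continuous fun q : ℤ → Pt d => q j from continuous_apply j).const_smul (φ (t - j))
  set U : ℕ → Set (ℤ → Pt d) := fun k => ⋃ t : ℝ, {q | 1 / ((k : ℝ) + 1) < ‖curve φ q t‖} with hU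
  obtain ⟨k, hk⟩ := hKc.elim_directed_cover U
    (fun k => isOpen_iUnion fun t => isOpen_lt continuous_const (hcont t).norm)
    (fun q hq => by
      have hq1 : ∀ j, ‖q j‖ ≤ 1 := fun j => by simpa using hq.1 j trivial
      have hq2 : 1 / 2 ≤ ‖q 0‖ := hq.2
      by_contra hc
      have : q = 0 := by
        refine eq_zero_of_curve_eq_zero h ha hnd hq1 fun t => ?_
        by_contra hne
        obtain ⟨k, hk⟩ := exists_nat_one_div_lt (norm_pos_iff.2 hne)
        exact hc (Set.mem_iUnion.2 ⟨k, Set.mem_iUnion.2 ⟨t, hk⟩⟩)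
      rw [this] at hq2
      norm_num at hq2)
    (Monotone.directed_le fun k k' hkk => Set.iUnion_mono fun t q hq =>
      lt_of_le_of_lt (one_div_le_one_div_of_le (Nat.cast_add_one_pos k)
        (by have : (k : ℝ) ≤ k' := by exact_mod_cast hkk
            exact add_le_add_left this 1)) hq)
  refine ⟨1 / ((k : ℝ) + 1), by positivity, fun q hq1 hq2 => ?_⟩
  obtain ⟨t, ht⟩ := Set.mem_iUnion.1 (hk ⟨fun j _ => by simpa using hq1 j, hq2⟩)
  exact ⟨t, ht⟩

/-- The integer translates of the basic limit function are stable. -/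
lemma exists_norm_le_of_curve (h : IsBasicLimit a β φ φ₁ φ₂) (ha : ∀ s, ∑ j, a s j = 1)
    (hnd : IsNondegenerate (linearRules d a)) :
    ∃ C : ℝ, 0 < C ∧ ∀ (q : ℤ → Pt d) (B b : ℝ), (∀ j, ‖q j‖ ≤ B) → (∀ t, ‖curve φ q t‖ ≤ b) →
      ∀ j, ‖q j‖ ≤ C * b := by
  obtain ⟨ε, hε, H⟩ := exists_lt_norm_curve h ha hnd
  refine ⟨1 / ε, by positivity, fun q B b hq hb j => ?_⟩
  have hb0 : 0 ≤ b := (norm_nonneg _).trans (hb 0)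
  have hbdd : BddAbove (Set.range fun j => ‖q j‖) := ⟨B, by rintro _ ⟨j, rfl⟩; exact hq j⟩
  set M := ⨆ j, ‖q j‖ with hM
  have hle : ∀ j, ‖q j‖ ≤ M := fun j => le_ciSup hbdd j
  refine (hle j).trans ?_
  by_cases hM0 : M ≤ 0
  · exact hM0.trans (by positivity)
  push Not at hM0
  obtain ⟨i, hi⟩ := exists_lt_of_lt_ciSup (show M / 2 < ⨆ j, ‖q j‖ by rw [← hM]; linarith)
  -- Normalizing by the supremum and shifting a nearly maximal coefficient to index `0` makes the
  -- compactness bound applicable.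
  obtain ⟨t, ht⟩ := H (M⁻¹ • fun j => q (j + i))
    (fun j => by
      rw [Pi.smul_apply, norm_smul, norm_inv, Real.norm_of_nonneg hM0.le, inv_mul_le_one₀ hM0]
      exact hle _)
    (by
      rw [Pi.smul_apply, norm_smul, norm_inv, Real.norm_of_nonneg hM0.le, zero_add,
        inv_mul_eq_div, le_div_iff₀ hM0]
      linarith)
  rw [curve_smul h.support, curve_shift, norm_smul, norm_inv, Real.norm_of_nonneg hM0.le,
    inv_mul_eq_div, lt_div_iff₀ hM0] at ht
  rw [div_mul_eq_mul_div, one_mul, le_div_iff₀ hε]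
  linarith [hb (t + i)]

/-- The second differences of the iterates decay like `4^{-l}`. -/
lemma exists_second_diff_linearSub_pow_le (h : IsBasicLimit a β φ φ₁ φ₂) (hβ : 0 < β)
    (ha : ∀ s, ∑ j, a s j = 1) (hnd : IsNondegenerate (linearRules d a)) :
    ∃ C : ℝ, 0 < C ∧ ∀ (l : ℕ) (q : ℤ → Pt d) (B : ℝ), (∀ j, ‖q j‖ ≤ B) → ∀ i : ℤ,
      ‖(linearSub (Pt d) a ^ l) q (i + 2) - (linearSub (Pt d) a ^ l) q (i + 1) -
        ((linearSub (Pt d) a ^ l) q (i + 1) - (linearSub (Pt d) a ^ l) q i)‖ ≤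
        C * ((1 / 4) ^ l * B) := by
  obtain ⟨C, hC0, hC⟩ := exists_norm_le_of_curve h ha hnd
  obtain ⟨K, hK0, hK⟩ := exists_norm_linearSub_pow_le (Pt d) h
  obtain ⟨M, hM0, hM⟩ := exists_bound_of_support (h.continuous₂ hβ) h.support₂
  refine ⟨C * ((12 * m + 12) * M), by positivity, fun l q B hq i => ?_⟩
  set p := (linearSub (Pt d) a ^ l) q with hp
  have hpb : ∀ i, ‖p i‖ ≤ K * B := hK l q B hq
  set D : ℤ → Pt d := ((fun j => p (j + 2)) - fun j => p (j + 1)) - ((fun j => p (j + 1)) - p)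
    with hD
  have hDb : ∀ i, ‖D i‖ ≤ K * B + K * B + (K * B + K * B) := fun i =>
    (norm_sub_le _ _).trans (add_le_add ((norm_sub_le _ _).trans (add_le_add (hpb _) (hpb _)))
      ((norm_sub_le _ _).trans (add_le_add (hpb _) (hpb _))))
  -- The curve of `D` is the second difference with step `2^{-l}` of the curve of `q`, hence
  -- `O(4^{-l})`. Stability carries this bound back to the coefficients.
  have key := hC D _ ((12 * m + 12) * (M * (1 / 2 ^ l) ^ 2 * B)) hDb (fun t => by
    rw [hD, curve_sub h.support, curve_sub h.support, curve_sub h.support, curve_shift,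
      curve_shift, hp, curve_linearSub_pow h l hq, curve_linearSub_pow h l hq,
      curve_linearSub_pow h l hq]
    refine norm_curve_second_diff_le h.support (fun j => ?_) hq
    have := abs_second_diff_le h.hasDerivAt h.hasDerivAt₁ hM (t / 2 ^ l - j) (1 / 2 ^ l)
    have e1 : t / 2 ^ l - j + 1 / 2 ^ l = (t + (1 : ℤ)) / 2 ^ l - j := by push_cast; ring
    have e2 : (t + (1 : ℤ)) / 2 ^ l - j + 1 / 2 ^ l = (t + (2 : ℤ)) / 2 ^ l - j := by
      push_cast; ring
    rw [e1, e2] at this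
    exact this) i
  refine key.trans (le_of_eq ?_)
  have : ((1 : ℝ) / 2 ^ l) ^ 2 = (1 / 4) ^ l := by
    rw [← one_div_pow, ← pow_mul, mul_comm, pow_mul]
    norm_num
  rw [this]
  ring

end Stability

/-! ### Local behaviour of the rules -/

section LocalRules

variable {d m : ℕ} {g : Rules d m} {ν : ℝ}

lemma subdivide_eq_rule {N : ℕ} (g : Rules d m) (P : Fin N → Pt d) (hN : m < N) (s : Fin 2) :
    subdivide g P ⟨s, by omega⟩ = g s fun j => P ⟨j, by omega⟩ := by
  fin_cases s <;> simp [subdivide]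

/-- Equivariance is postulated for whole chains. Padding `y` by zeros makes it a chain whose new
point at position `s` reads only `y`. -/
lemma IsGLUE.rule_similarity [NeZero d] (hG : IsGLUE g ν) (s : Fin 2) (y : Fin (m + 1) → Pt d) {ρ : ℝ}
    (hρ : 0 < ρ) (Q : Pt d ≃ₗᵢ[ℝ] Pt d) (t : Pt d) :
    g s (fun j => similarity ρ Q t (y j)) = similarity ρ Q t (g s y) := by
  have h := congrFun (hG.geometric (spread m) le_rfl
    (fun i => if h : (i : ℕ) < m + 1 then y ⟨i, h⟩ else 0) ρ hρ Q t) ⟨s, by simp only [spread]; omega⟩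
  rw [subdivide_eq_rule _ _ (by simp only [spread]; omega),
    subdivide_eq_rule _ _ (by simp only [spread]; omega)] at h
  simpa only [dif_pos (Fin.is_lt _), Fin.eta] using h

/-- The derivative of the rule with weights `a`. -/
def weightedSum (d : ℕ) {m : ℕ} (a : Fin (m + 1) → ℝ) : (Fin (m + 1) → Pt d) →L[ℝ] Pt d :=
  ∑ j, a j • ContinuousLinearMap.proj j

lemma weightedSum_apply (a : Fin (m + 1) → ℝ) (y : Fin (m + 1) → Pt d) :
    weightedSum d a y = ∑ j, a j • y j := by
  simp [weightedSum]

lemma IsC1HolderNear.differentiableAt {E F : Type*} [NormedAddCommGroup E] [NormedSpace ℝ E]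
    [NormedAddCommGroup F] [NormedSpace ℝ F] {f : E → F} {x : E} (h : IsC1HolderNear ν f x) :
    DifferentiableAt ℝ f x := by
  obtain ⟨U, hU, hx, hf, -⟩ := h
  exact (hf.differentiableOn one_ne_zero).differentiableAt (hU.mem_nhds hx)

/-- First order Taylor expansion of `C^{1,ν}` functions. -/
lemma IsC1HolderNear.exists_remainder_le {E F : Type*} [NormedAddCommGroup E] [NormedSpace ℝ E]
    [NormedAddCommGroup F] [NormedSpace ℝ F] {f : E → F} {x : E} (hν : 0 < ν)
    (h : IsC1HolderNear ν f x) :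
    ∃ C δ : ℝ, 0 < C ∧ 0 < δ ∧ ∀ y, ‖y‖ ≤ δ →
      ‖f (x + y) - f x - fderiv ℝ f x y‖ ≤ C * ‖y‖ ^ ν * ‖y‖ := by
  obtain ⟨U, hU, hx, hf, C, hC⟩ := h
  obtain ⟨δ, hδ, hball⟩ := Metric.isOpen_iff.1 hU x hx
  refine ⟨max C 1, δ / 2, by positivity, by positivity, fun y hy => ?_⟩
  -- On the ball of radius `‖y‖` the derivative varies by at most `C ‖y‖ ^ ν`; the mean value
  -- inequality does the rest.
  have hsub : Metric.closedBall x ‖y‖ ⊆ U :=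
    (Metric.closedBall_subset_ball (by linarith)).trans hball
  have key := Convex.norm_image_sub_le_of_norm_fderiv_le' (𝕜 := ℝ) (f := f) (φ := fderiv ℝ f x)
    (C := max C 1 * ‖y‖ ^ ν) (s := Metric.closedBall x ‖y‖) (x := x) (y := x + y)
    (fun z hz => (hf.differentiableOn one_ne_zero).differentiableAt (hU.mem_nhds (hsub hz)))
    (fun z hz => by
      refine (hC z (hsub hz) x hx).trans ?_
      have hzy : ‖z - x‖ ≤ ‖y‖ := by rwa [← dist_eq_norm]
      exact mul_le_mul (le_max_left _ _) (Real.rpow_le_rpow (norm_nonneg _) hzy hν.le)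
        (Real.rpow_nonneg (norm_nonneg _) _) (by positivity))
    (convex_closedBall x ‖y‖) (Metric.mem_closedBall_self (norm_nonneg _)) (by simp)
  rwa [add_sub_cancel_left] at key

variable [NeZero d] {A : Fin 2 → Matrix (Fin (spread m)) (Fin (spread m)) ℝ}

/-- The rules of the linear companion are the derivatives of the rules at the standard chain. -/
lemma hasFDerivAt_rule (hG : IsGLUE g ν) (hA : IsLocallyLinear g A) (s : Fin 2) :
    HasFDerivAt (g s) (weightedSum d (companionWeights A s)) (stdChain d (m + 1)) := by
  -- `R` keeps the first `m + 1` points. Entry `0` of the self-map is the rule composed with `R`, so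
  -- its derivative is known in two ways.
  set R : (Fin (spread m) → Pt d) →L[ℝ] (Fin (m + 1) → Pt d) :=
    ContinuousLinearMap.pi fun j =>
      ContinuousLinearMap.proj (⟨j, by simp only [spread]; omega⟩ : Fin (spread m)) with hR
  have hd := ((hG.regular s).differentiableAt).hasFDerivAt
  have h1 : HasFDerivAt (fun p => g s (R p)) ((fderiv ℝ (g s) (stdChain d (m + 1))).comp R)
      (stdChain d (spread m)) :=
    HasFDerivAt.comp (g := g s) (f := R) (stdChain d (spread m)) hd R.hasFDerivAt
  have h2 := (hasFDerivAt_pi'.1 (hA s)) 0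
  have e : (fun p => selfMap g s p 0) = fun p => g s (R p) := by
    funext p
    exact subdivide_eq_rule g p (by simp only [spread]; omega) s
  rw [e] at h2
  have h3 := h1.unique h2
  suffices fderiv ℝ (g s) (stdChain d (m + 1)) = weightedSum d (companionWeights A s) by
    rwa [this] at hd
  ext1 y
  -- Zero padding removes the entries of the matrix row that are not companion weights.
  set p : Fin (spread m) → Pt d := fun i => if h : (i : ℕ) < m + 1 then y ⟨i, h⟩ else 0 with hp
  have hRp : R p = y := by
    funext j
    exact dif_pos j.2
  have h4 := congrArg (fun T => T p) h3
  simp only [ContinuousLinearMap.comp_apply, hRp] at h4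
  rw [h4, weightedSum_apply]
  have h5 : (ContinuousLinearMap.proj (R := ℝ) (φ := fun _ : Fin (spread m) => Pt d) 0)
      (matrixAction d (A s) p) = ∑ j, A s 0 j • p j := by
    simp [matrixAction]
  rw [h5]
  have h6 : ∑ j : Fin (m + 1), companionWeights A s j • y j =
      ∑ j : Fin (m + 1), A s 0 (Fin.castLE (by simp only [spread]; omega) j) •
        p (Fin.castLE (by simp only [spread]; omega) j) := by
    refine Finset.sum_congr rfl fun j _ => ?_
    rw [show p (Fin.castLE (by simp only [spread]; omega) j) = y j from dif_pos j.2]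
    rfl
  rw [h6, ← Finset.sum_image (f := fun j => A s 0 j • p j)
    (g := Fin.castLE (show m + 1 ≤ spread m by simp only [spread]; omega))
    (s := Finset.univ) (fun i _ j _ hij => Fin.castLE_injective _ hij)]
  symm
  refine Finset.sum_subset (Finset.subset_univ _) fun j _ hj => ?_
  have : ¬ (j : ℕ) < m + 1 := by
    intro hlt
    exact hj (Finset.mem_image.2 ⟨⟨j, hlt⟩, Finset.mem_univ _, rfl⟩)
  rw [show p j = 0 from dif_neg this, smul_zero]

lemma norm_unitVec : ‖unitVec d‖ = 1 := by
  simp [unitVec]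

lemma unitVec_ne_zero : unitVec d ≠ 0 := norm_pos_iff.1 (by rw [norm_unitVec]; exact one_pos)

/-- Differentiate the translation equivariance of the rule in direction `e`. -/
lemma sum_companionWeights (hG : IsGLUE g ν) (hA : IsLocallyLinear g A) (s : Fin 2) :
    ∑ j, companionWeights A s j = 1 := by
  have h1 := (hasFDerivAt_rule hG hA s).hasLineDerivAt (fun _ => unitVec d)
  have e : ∀ t : ℝ, g s (stdChain d (m + 1) + t • fun _ => unitVec d) =
      g s (stdChain d (m + 1)) + t • unitVec d := by
    intro t
    have := hG.rule_similarity s (stdChain d (m + 1)) one_pos (LinearIsometryEquiv.refl ℝ (Pt d))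
      (t • unitVec d)
    simp only [similarity, one_smul, LinearIsometryEquiv.coe_refl, id_eq] at this
    exact this
  have h2 : HasDerivAt (fun t : ℝ => g s (stdChain d (m + 1) + t • fun _ => unitVec d))
      (unitVec d) 0 := by
    simp only [e]
    simpa using ((hasDerivAt_id (0 : ℝ)).smul_const (unitVec d)).const_add (g s (stdChain d (m + 1)))
  have h3 := HasDerivAt.unique h1 h2
  rw [weightedSum_apply, ← Finset.sum_smul] at h3
  have h4 : (∑ j, companionWeights A s j - 1) • unitVec d = 0 := by
    rw [sub_smul, h3, one_smul, sub_self]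
  rcases smul_eq_zero.1 h4 with h | h
  · linarith
  · exact absurd h unitVec_ne_zero

/-- Euler's identity: scaling equivariance makes the rule homogeneous of degree one along the ray
through the standard chain. -/
lemma weightedSum_stdChain (hG : IsGLUE g ν) (hA : IsLocallyLinear g A) (s : Fin 2) :
    weightedSum d (companionWeights A s) (stdChain d (m + 1)) = g s (stdChain d (m + 1)) := by
  have h1 := (hasFDerivAt_rule hG hA s).hasLineDerivAt (stdChain d (m + 1))
  have e : ∀ᶠ t : ℝ in 𝓝 0, g s (stdChain d (m + 1) + t • stdChain d (m + 1)) =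
      g s (stdChain d (m + 1)) + t • g s (stdChain d (m + 1)) := by
    filter_upwards [lt_mem_nhds (show (-1 : ℝ) < 0 by norm_num)] with t ht
    have := hG.rule_similarity s (stdChain d (m + 1)) (show 0 < 1 + t by linarith)
      (LinearIsometryEquiv.refl ℝ (Pt d)) 0
    have e1 : stdChain d (m + 1) + t • stdChain d (m + 1) =
        fun j => similarity (1 + t) (LinearIsometryEquiv.refl ℝ (Pt d)) 0 (stdChain d (m + 1) j) := by
      funext j
      simp [similarity, add_smul]
    rw [e1, this]
    simp [similarity, add_smul]
  have h2 : HasDerivAt (fun t : ℝ => g s (stdChain d (m + 1) + t • stdChain d (m + 1)))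
      (g s (stdChain d (m + 1))) 0 := by
    refine HasDerivAt.congr_of_eventuallyEq ?_ e
    simpa using ((hasDerivAt_id (0 : ℝ)).smul_const (g s (stdChain d (m + 1)))).const_add
      (g s (stdChain d (m + 1)))
  exact HasDerivAt.unique h1 h2

/-- The companion maps the standard chain as the scheme does, and equilinearity prescribes that
image. The gap of `1 / 2` between the two moments is what halves the step of affine data. -/
lemma exists_sum_companionWeights_mul (hG : IsGLUE g ν) (hA : IsLocallyLinear g A) :
    ∃ c : ℝ, ∀ s : Fin 2, ∑ j, companionWeights A s j * (j : ℕ) = ((s : ℕ) : ℝ) / 2 + c := by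
  obtain ⟨τ, -, -, h⟩ := hG.equilinear
  refine ⟨(1 + (m + τ)) / 2 - 1, fun s => ?_⟩
  have h1 := h ⟨s, by simp only [spread]; omega⟩
  rw [subdivide_eq_rule _ _ (by simp only [spread]; omega)] at h1
  have h2 := (weightedSum_stdChain hG hA s).trans h1
  rw [weightedSum_apply] at h2
  simp only [stdChain, smul_smul, ← Finset.sum_smul] at h2
  have h3 := smul_left_injective ℝ (unitVec_ne_zero (d := d)) h2
  simp only [mul_add, mul_one, Finset.sum_add_distrib, sum_companionWeights hG hA s] at h3
  linarith

/-- Since the companion agrees with the rule at the standard chain, the first-order Taylor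
polynomial is the companion itself, and the remainder is the whole difference. -/
lemma exists_rule_sub_le_near_stdChain (hG : IsGLUE g ν) (hA : IsLocallyLinear g A) :
    ∃ C δ : ℝ, 0 < C ∧ 0 < δ ∧ ∀ s y, ‖y‖ ≤ δ →
      ‖g s (stdChain d (m + 1) + y) -
        weightedSum d (companionWeights A s) (stdChain d (m + 1) + y)‖ ≤ C * ‖y‖ ^ ν * ‖y‖ := by
  choose C δ hC hδ H using fun s => (hG.regular s).exists_remainder_le hG.regularity_pos
  refine ⟨max (C 0) (C 1), min (δ 0) (δ 1), lt_max_of_lt_left (hC 0), lt_min (hδ 0) (hδ 1),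
    fun s y hy => ?_⟩
  have h1 : C s ≤ max (C 0) (C 1) := by
    fin_cases s
    · exact le_max_left _ _
    · exact le_max_right _ _
  have h2 : min (δ 0) (δ 1) ≤ δ s := by
    fin_cases s
    · exact min_le_left _ _
    · exact min_le_right _ _
  have key := H s y (hy.trans h2)
  rw [(hasFDerivAt_rule hG hA s).fderiv] at key
  rw [map_add, weightedSum_stdChain hG hA, ← sub_sub]
  refine key.trans ?_
  gcongr

/-- On chains close to an equidistant linear one, the rules are close to the linear companion. -/
lemma exists_rule_sub_le (hG : IsGLUE g ν) (hA : IsLocallyLinear g A) :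
    ∃ C δ : ℝ, 0 < C ∧ 0 < δ ∧ ∀ (s : Fin 2) (y : Fin (m + 1) → Pt d) (u v : Pt d) (η : ℝ),
      u ≠ 0 → η ≤ δ → (∀ j, ‖y j - (v + ((j : ℕ) : ℝ) • u)‖ ≤ η * ‖u‖) →
      ‖g s y - weightedSum d (companionWeights A s) y‖ ≤ C * η ^ ν * (η * ‖u‖) := by
  obtain ⟨C, δ, hC, hδ, H⟩ := exists_rule_sub_le_near_stdChain hG hA
  refine ⟨C, δ, hC, hδ, fun s y u v η hu hη hy => ?_⟩
  have hu0 : 0 < ‖u‖ := norm_pos_iff.2 hu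
  have hη0 : 0 ≤ η := nonneg_of_mul_nonneg_left ((norm_nonneg _).trans (hy 0)) hu0
  -- Two unit vectors are exchanged by the reflection that fixes the hyperplane between them.
  obtain ⟨Q, hQ⟩ : ∃ Q : Pt d ≃ₗᵢ[ℝ] Pt d, Q (unitVec d) = ‖u‖⁻¹ • u :=
    ⟨_, Submodule.reflection_sub (by
      rw [norm_unitVec, norm_smul, norm_inv, norm_norm, inv_mul_cancel₀ hu0.ne'])⟩
  have hQu : ‖u‖ • Q (unitVec d) = u := by rw [hQ, smul_inv_smul₀ hu0.ne']
  set x : Fin (m + 1) → Pt d := fun j => Q.symm (‖u‖⁻¹ • (y j - (v + ((j : ℕ) : ℝ) • u))) with hx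
  have hxn : ‖x‖ ≤ η := by
    rw [pi_norm_le_iff_of_nonneg hη0]
    intro j
    rw [hx, LinearIsometryEquiv.norm_map, norm_smul, norm_inv, norm_norm, inv_mul_le_iff₀ hu0,
      mul_comm]
    exact hy j
  -- The translation is `v - u` rather than `v` because the standard chain starts at `e`.
  have hyx : y = fun j => similarity ‖u‖ Q (v - u) ((stdChain d (m + 1) + x) j) := by
    funext j
    simp only [similarity, Pi.add_apply, map_add, stdChain, map_smul, smul_add, hx,
      LinearIsometryEquiv.apply_symm_apply]
    rw [smul_inv_smul₀ hu0.ne', smul_comm, hQu, add_smul, one_smul]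
    abel
  have hg : g s y = similarity ‖u‖ Q (v - u) (g s (stdChain d (m + 1) + x)) := by
    conv_lhs => rw [hyx]
    exact hG.rule_similarity s _ hu0 Q (v - u)
  -- The companion shares the equivariance: weights summing to one take care of the translation.
  have hw : weightedSum d (companionWeights A s) y = similarity ‖u‖ Q (v - u)
      (weightedSum d (companionWeights A s) (stdChain d (m + 1) + x)) := by
    conv_lhs => rw [hyx]
    simp only [weightedSum_apply, similarity, smul_add, Finset.sum_add_distrib, ← Finset.sum_smul,
      sum_companionWeights hG hA s, one_smul, map_sum, map_smul, Finset.smul_sum, smul_comm ‖u‖]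
  have hdiff : g s y - weightedSum d (companionWeights A s) y = ‖u‖ • Q
      (g s (stdChain d (m + 1) + x) -
        weightedSum d (companionWeights A s) (stdChain d (m + 1) + x)) := by
    rw [hg, hw, similarity, similarity, add_sub_add_right_eq_sub, ← smul_sub, ← map_sub]
  rw [hdiff, norm_smul, norm_norm, LinearIsometryEquiv.norm_map]
  calc _ ≤ ‖u‖ * (C * ‖x‖ ^ ν * ‖x‖) :=
        mul_le_mul_of_nonneg_left (H s x (hxn.trans hη)) (norm_nonneg _)
    _ ≤ ‖u‖ * (C * η ^ ν * η) := by
        have := hG.regularity_pos.le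
        gcongr
    _ = _ := by ring

end LocalRules

/-! ### Second differences -/

section SecondDiff

/-- The second difference at `j` of a bi-infinite sequence. -/
def secondDiff {E : Type*} [AddCommGroup E] (p : ℤ → E) (j : ℤ) : E :=
  p (j + 2) - p (j + 1) - (p (j + 1) - p j)

variable {E : Type*} [NormedAddCommGroup E] [NormedSpace ℝ E]

lemma norm_first_diff_sub_le {E : Type*} [NormedAddCommGroup E] {y : ℕ → E} {K : ℕ} {D : ℝ}
    (h : ∀ j, j + 2 ≤ K → ‖y (j + 2) - y (j + 1) - (y (j + 1) - y j)‖ ≤ D) :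
    ∀ j, j + 1 ≤ K → ‖y (j + 1) - y j - (y 1 - y 0)‖ ≤ j * D := by
  intro j
  induction j with
  | zero => intro _; simp
  | succ j ih =>
    intro hj
    have e : y (j + 1 + 1) - y (j + 1) - (y 1 - y 0) =
        (y (j + 2) - y (j + 1) - (y (j + 1) - y j)) + (y (j + 1) - y j - (y 1 - y 0)) := by
      abel
    rw [e]
    refine (norm_add_le _ _).trans ?_
    have := h j hj
    have := ih (by omega)
    push_cast
    linarith

/-- Second differences are summed twice; the factor `j (j - 1) / 2` is relaxed to `j ^ 2`. -/
lemma norm_sub_linear_le {y : ℕ → E} {K : ℕ} {D : ℝ} (hD : 0 ≤ D)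
    (h : ∀ j, j + 2 ≤ K → ‖y (j + 2) - y (j + 1) - (y (j + 1) - y j)‖ ≤ D) :
    ∀ j : ℕ, j ≤ K → ‖y j - (y 0 + (j : ℝ) • (y 1 - y 0))‖ ≤ (j : ℝ) ^ 2 * D := by
  intro j
  induction j with
  | zero => intro _; simp
  | succ j ih =>
    intro hj
    have e : y (j + 1) - (y 0 + ((j + 1 : ℕ) : ℝ) • (y 1 - y 0)) =
        (y (j + 1) - y j - (y 1 - y 0)) + (y j - (y 0 + (j : ℝ) • (y 1 - y 0))) := by
      push_cast
      rw [add_smul, one_smul]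
      abel
    rw [e]
    refine (norm_add_le _ _).trans ?_
    have h1 := norm_first_diff_sub_le h j hj
    have h2 := ih (by omega)
    push_cast
    nlinarith [mul_nonneg (Nat.cast_nonneg (α := ℝ) j) hD]

end SecondDiff

/-- The first moment of the rule with index `s` supplies the half that is lost when an odd `k` is
halved: `⌊k / 2⌋ + s / 2 = k / 2`. -/
lemma linearSub_affine {d m : ℕ} {a : Fin 2 → Fin (m + 1) → ℝ} (ha : ∀ s, ∑ j, a s j = 1) {c : ℝ}
    (hc : ∀ s : Fin 2, ∑ j, a s j * (j : ℕ) = ((s : ℕ) : ℝ) / 2 + c) (v u : Pt d) (k : ℤ) :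
    linearSub (Pt d) a (fun j => v + (j : ℝ) • u) k = v + ((k : ℝ) / 2 + c) • u := by
  have hk : ((k / 2 : ℤ) : ℝ) + ((parity k : ℕ) : ℝ) / 2 = (k : ℝ) / 2 := by
    have h1 : 2 * (k / 2) + ((parity k : ℕ) : ℤ) = k := by
      unfold parity
      split_ifs with h
      · simp; omega
      · simp; omega
    have h2 : 2 * ((k / 2 : ℤ) : ℝ) + ((parity k : ℕ) : ℝ) = k := by exact_mod_cast h1
    linarith
  rw [linearSub_apply]
  simp only [smul_add, Finset.sum_add_distrib, ← Finset.sum_smul, smul_smul, ha, one_smul,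
    Int.cast_add, mul_add, ← Finset.sum_mul, one_mul, Int.cast_natCast, hc]
  rw [← hk]
  congr 2
  ring

/-! ### Deviation of the rules from the companion, and edge lengths -/

section ErrorBounds

variable {d m : ℕ} [NeZero d] {g : Rules d m} {ν : ℝ}
  {A : Fin 2 → Matrix (Fin (spread m)) (Fin (spread m)) ℝ}

/-- The rules differ from the linear companion by a power of the relative second differences. -/
lemma exists_rule_sub_linearSub_le (hm : 0 < m) (hG : IsGLUE g ν) (hA : IsLocallyLinear g A) :
    ∃ C δ : ℝ, 0 < C ∧ 0 < δ ∧ ∀ (p : ℤ → Pt d) (k i : ℤ) (D : ℝ), k / 2 = i → 0 ≤ D →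
      (∀ j, i ≤ j → j + 2 ≤ i + m → ‖secondDiff p j‖ ≤ D) → p (i + 1) - p i ≠ 0 →
      D ≤ δ * ‖p (i + 1) - p i‖ →
      ‖g (parity k) (fun j => p (i + (j : ℕ))) - linearSub (Pt d) (companionWeights A) p k‖ ≤
        C * (D / ‖p (i + 1) - p i‖) ^ ν * D := by
  obtain ⟨C, δ, hC, hδ, H⟩ := exists_rule_sub_le hG hA
  have hm' : (0 : ℝ) < m := by exact_mod_cast hm
  refine ⟨C * ((m : ℝ) ^ 2) ^ ν * (m : ℝ) ^ 2, δ / (m : ℝ) ^ 2, by positivity, by positivity,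
    fun p k i D hki hD hp hu hDu => ?_⟩
  subst hki
  set u := p (k / 2 + 1) - p (k / 2) with hu'
  have hu0 : 0 < ‖u‖ := norm_pos_iff.2 hu
  have hlin := norm_sub_linear_le (y := fun j : ℕ => p (k / 2 + j)) (K := m) hD (fun j hj => by
    have := hp (k / 2 + j) (by omega) (by omega)
    simpa [secondDiff, add_assoc] using this)
  simp only [Nat.cast_zero, add_zero, Nat.cast_one, ← hu'] at hlin
  -- The reference chain continues the edge `u` from `p (k / 2)`. Over `m` steps the points stray
  -- from it by at most `m ^ 2 * D`, hence the choice of `η`.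
  have key := H (parity k) (fun j => p (k / 2 + (j : ℕ))) u (p (k / 2)) ((m : ℝ) ^ 2 * (D / ‖u‖)) hu
    (by
      rw [div_mul_eq_mul_div, le_div_iff₀ (by positivity)] at hDu
      rw [← mul_div_assoc, div_le_iff₀ hu0]
      linarith) (fun j => by
      have hj : ((j : ℕ) : ℝ) ≤ m := by exact_mod_cast Nat.lt_succ_iff.1 j.2
      refine (hlin j (Nat.lt_succ_iff.1 j.2)).trans ?_
      rw [mul_assoc, div_mul_cancel₀ _ hu0.ne']
      gcongr)
  rw [weightedSum_apply] at key
  rw [linearSub_apply]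
  refine key.trans (le_of_eq ?_)
  rw [Real.mul_rpow (by positivity) (by positivity), mul_assoc ((m : ℝ) ^ 2),
    div_mul_cancel₀ _ hu0.ne']
  ring

/-- The second differences of the first `N` points are small relative to nearby first differences. -/
def IsFlat {E : Type*} [NormedAddCommGroup E] (m : ℕ) (p : ℤ → E) (N : ℤ) (σ : ℝ) : Prop :=
  ∀ i, 0 ≤ i → i + 1 < N → p (i + 1) - p i ≠ 0 ∧ ∀ j, i ≤ j → j + 2 ≤ i + 2 * m → j + 2 < N →
    ‖secondDiff p j‖ ≤ σ * ‖p (i + 1) - p i‖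

/-- The distance of new neighbors is about half the distance of old ones. -/
lemma exists_le_norm_first_diff (hm : 0 < m) (hG : IsGLUE g ν) (hA : IsLocallyLinear g A) :
    ∃ C δ : ℝ, 0 < C ∧ 0 < δ ∧ ∀ (p : ℤ → Pt d) (N : ℤ) (σ : ℝ), 0 ≤ σ → σ ≤ δ →
      IsFlat m p N σ → ∀ k, 0 ≤ k → k + 1 < 2 * (N - m) →
      (1 / 2 - C * σ) * ‖p (k / 2 + 1) - p (k / 2)‖ ≤
        ‖g (parity (k + 1)) (fun j => p ((k + 1) / 2 + (j : ℕ))) -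
          g (parity k) (fun j => p (k / 2 + (j : ℕ)))‖ := by
  obtain ⟨C, δ, hC, hδ, H⟩ := exists_rule_sub_linearSub_le hm hG hA
  obtain ⟨c, hc⟩ := exists_sum_companionWeights_mul hG hA
  have ha := sum_companionWeights hG hA
  set a := companionWeights A
  have hS0 : 0 ≤ ∑ s, ∑ j, |a s j| :=
    Finset.sum_nonneg fun s _ => Finset.sum_nonneg fun j _ => abs_nonneg _
  set S := 1 + ∑ s, ∑ j, |a s j| with hS
  have hS1 : 0 < S := by linarith
  -- Two new points contribute one linear error each, and rule errors with factors `1` and `2`,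
  -- because the next edge has length at most `2 ‖u‖`. The bound `σ ≤ 1` gives that length and `σ ^
  -- ν ≤ 1`.
  refine ⟨2 * (S * ((m : ℝ) + 1) ^ 2) + 3 * C, min δ 1, by positivity, by positivity,
    fun p N σ hσ0 hσ hp k hk0 hk1 => ?_⟩
  have hσδ := hσ.trans (min_le_left _ _)
  have hσ1 := hσ.trans (min_le_right _ _)
  obtain ⟨hu, hsd⟩ := hp (k / 2) (by omega) (by omega)
  set u := p (k / 2 + 1) - p (k / 2) with hu'
  have hu0 : 0 < ‖u‖ := norm_pos_iff.2 hu
  have hν := hG.regularity_pos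
  have herr : ∀ k', 0 ≤ k' → k' < 2 * (N - m) →
      ‖g (parity k') (fun j => p (k' / 2 + (j : ℕ))) - linearSub (Pt d) a p k'‖ ≤
        C * σ * ‖p (k' / 2 + 1) - p (k' / 2)‖ := by
    intro k' h0 h1
    obtain ⟨h2, h3⟩ := hp (k' / 2) (by omega) (by omega)
    have h4 : 0 < ‖p (k' / 2 + 1) - p (k' / 2)‖ := norm_pos_iff.2 h2
    refine (H p k' (k' / 2) (σ * ‖p (k' / 2 + 1) - p (k' / 2)‖) rfl (by positivity)
      (fun j hj1 hj2 => h3 j hj1 (by omega) (by omega)) h2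
      (mul_le_mul_of_nonneg_right hσδ h4.le)).trans ?_
    rw [mul_div_cancel_right₀ _ h4.ne', ← mul_assoc]
    refine mul_le_mul_of_nonneg_right (mul_le_mul_of_nonneg_right ?_ hσ0) h4.le
    exact mul_le_of_le_one_right hC.le (Real.rpow_le_one hσ0 hσ1 hν.le)
  have hnext : ‖p ((k + 1) / 2 + 1) - p ((k + 1) / 2)‖ ≤ 2 * ‖u‖ := by
    rcases (by omega : (k + 1) / 2 = k / 2 ∨ (k + 1) / 2 = k / 2 + 1) with e | e
    · rw [e]
      linarith
    · rw [e]
      have h1 := hsd (k / 2) le_rfl (by omega) (by omega)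
      have h2 : p (k / 2 + 1 + 1) - p (k / 2 + 1) = secondDiff p (k / 2) + u := by
        simp [secondDiff, hu', add_assoc]
      rw [h2]
      refine (norm_add_le _ _).trans ?_
      nlinarith
  set q : ℤ → Pt d := fun j => (p (k / 2) + (-((k / 2 : ℤ) : ℝ)) • u) + (j : ℝ) • u with hq
  -- The rule for `k + 1` may start at `k / 2 + 1`, so points up to offset `m + 1` matter; flatness
  -- reaches offset `2 m ≥ m + 1`.
  have hlin : ∀ j : ℕ, j ≤ m + 1 → k / 2 + j < N →
      ‖(p - q) (k / 2 + j)‖ ≤ ((m : ℝ) + 1) ^ 2 * σ * ‖u‖ := by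
    intro j hj hjN
    have h1 := norm_sub_linear_le (y := fun j : ℕ => p (k / 2 + j)) (K := j)
      (show 0 ≤ σ * ‖u‖ by positivity) (fun j' hj' => by
        have := hsd (k / 2 + j') (by omega) (by omega) (by omega)
        simpa [secondDiff, add_assoc] using this) j le_rfl
    simp only [Nat.cast_zero, add_zero, Nat.cast_one, ← hu'] at h1
    have h2 : (p - q) (k / 2 + j) = p (k / 2 + j) - (p (k / 2) + (j : ℝ) • u) := by
      simp only [Pi.sub_apply, hq, Int.cast_add, Int.cast_natCast, add_smul, neg_smul]
      abel
    rw [h2]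
    refine h1.trans ?_
    rw [mul_assoc]
    have : (j : ℝ) ≤ m + 1 := by exact_mod_cast hj
    gcongr
  have hL : ∀ k', k / 2 ≤ k' / 2 → k' / 2 ≤ k / 2 + 1 → k' < 2 * (N - m) →
      ‖linearSub (Pt d) a (p - q) k'‖ ≤ S * (((m : ℝ) + 1) ^ 2 * σ * ‖u‖) := by
    intro k' h1 h2 h3
    refine norm_linearSub_le_of_local a (by positivity) fun j hj => ?_
    rcases (by omega : k' / 2 = k / 2 ∨ k' / 2 = k / 2 + 1) with e | e
    · rw [e]
      exact hlin j (by omega) (by omega)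
    · rw [e]
      have := hlin (j + 1) (by omega) (by push_cast; omega)
      have e2 : k / 2 + ((j + 1 : ℕ) : ℤ) = k / 2 + 1 + j := by push_cast; ring
      rwa [e2] at this
  have hqd : linearSub (Pt d) a q (k + 1) - linearSub (Pt d) a q k = (1 / 2 : ℝ) • u := by
    rw [hq, linearSub_affine ha hc, linearSub_affine ha hc, add_sub_add_left_eq_sub, ← sub_smul]
    congr 1
    push_cast
    ring
  have e0 := herr k hk0 (by omega)
  have e1 := (herr (k + 1) (by omega) hk1).trans
    (mul_le_mul_of_nonneg_left hnext (by positivity))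
  have e2 := hL k le_rfl (by omega) (by omega)
  have e3 := hL (k + 1) (by omega) (by omega) hk1
  set G₁ := g (parity (k + 1)) (fun j => p ((k + 1) / 2 + (j : ℕ)))
  set G₀ := g (parity k) (fun j => p (k / 2 + (j : ℕ)))
  have hsplit : (1 / 2 : ℝ) • u = (G₁ - G₀) - (G₁ - linearSub (Pt d) a p (k + 1)) +
      (G₀ - linearSub (Pt d) a p k) - linearSub (Pt d) a (p - q) (k + 1) +
      linearSub (Pt d) a (p - q) k := by
    rw [← hqd, map_sub, Pi.sub_apply, Pi.sub_apply]
    abel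
  have hn := congrArg norm hsplit
  rw [norm_smul, Real.norm_of_nonneg (by norm_num : (0 : ℝ) ≤ 1 / 2)] at hn
  have t1 := norm_add_le ((G₁ - G₀) - (G₁ - linearSub (Pt d) a p (k + 1)) +
      (G₀ - linearSub (Pt d) a p k) - linearSub (Pt d) a (p - q) (k + 1))
      (linearSub (Pt d) a (p - q) k)
  have t2 := norm_sub_le ((G₁ - G₀) - (G₁ - linearSub (Pt d) a p (k + 1)) +
      (G₀ - linearSub (Pt d) a p k)) (linearSub (Pt d) a (p - q) (k + 1))
  have t3 := norm_add_le ((G₁ - G₀) - (G₁ - linearSub (Pt d) a p (k + 1)))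
      (G₀ - linearSub (Pt d) a p k)
  have t4 := norm_sub_le (G₁ - G₀) (G₁ - linearSub (Pt d) a p (k + 1))
  linarith

end ErrorBounds

/-! ### Relative distortion -/

section Distortion

variable {d n : ℕ}

/-- The projection onto linear chains as a continuous linear map for the maximum norm. -/
def linPartL (d n : ℕ) : (Fin n → Pt d) →L[ℝ] (Fin n → Pt d) :=
  ((PiLp.continuousLinearEquiv 2 ℝ (fun _ : Fin n => Pt d)).toContinuousLinearMap.comp
    (linearChains d n).starProjection).comp
      (PiLp.continuousLinearEquiv 2 ℝ (fun _ : Fin n => Pt d)).symm.toContinuousLinearMap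

lemma linPartL_apply (p : Fin n → Pt d) : linPartL d n p = linPart p := rfl

lemma linPart_eq_self {p : Fin n → Pt d} (hp : diff (diff p) = 0) : linPart p = p := by
  have : (linearChains d n).starProjection (WithLp.toLp 2 p) = WithLp.toLp 2 p :=
    Submodule.starProjection_eq_self_iff.2 hp
  rw [linPart, this]

lemma norm_diff_le (p : Fin n → Pt d) : ‖diff p‖ ≤ 2 * ‖p‖ := by
  rw [pi_norm_le_iff_of_nonneg (by positivity)]
  intro i
  refine (norm_sub_le _ _).trans ?_
  linarith [norm_le_pi_norm p ⟨i + 1, by omega⟩, norm_le_pi_norm p ⟨i, by omega⟩]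

lemma diff_sub (p q : Fin n → Pt d) : diff (p - q) = diff p - diff q := by
  funext i
  simp only [diff, Pi.sub_apply]
  abel

lemma norm_dist_diff_zero_le (p : Fin n → Pt d) (hn : 2 ≤ n) (i : Fin (n - 1)) :
    ‖diff p i - diff p ⟨0, by omega⟩‖ ≤ n * ‖diff (diff p)‖ := by
  have h := norm_first_diff_sub_le (y := fun j => if h : j < n then p ⟨j, h⟩ else 0) (K := n - 1)
    (D := ‖diff (diff p)‖) (fun j hj => by
      have := norm_le_pi_norm (diff (diff p)) ⟨j, by omega⟩
      rw [dif_pos (by omega), dif_pos (by omega), dif_pos (by omega)]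
      exact this) i (by omega)
  rw [dif_pos (by omega), dif_pos (by omega), dif_pos (by omega), dif_pos (by omega)] at h
  refine h.trans (mul_le_mul_of_nonneg_right ?_ (norm_nonneg _))
  exact_mod_cast (by omega : (i : ℕ) ≤ n)

lemma norm_diff_sub_diff_le (p : Fin n → Pt d) (hn : 2 ≤ n) (i j : Fin (n - 1)) :
    ‖diff p i - diff p j‖ ≤ 2 * n * ‖diff (diff p)‖ := by
  have h1 := norm_dist_diff_zero_le p hn i
  have h2 := norm_dist_diff_zero_le p hn j
  have h3 := norm_sub_le (diff p i - diff p ⟨0, by omega⟩) (diff p j - diff p ⟨0, by omega⟩)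
  rw [sub_sub_sub_cancel_right] at h3
  linarith

/-- The first differences of a chain and of its linear component are close. -/
lemma exists_norm_diff_linPart_sub_le (d : ℕ) (hn : 2 ≤ n) :
    ∃ C : ℝ, 0 < C ∧ ∀ p : Fin n → Pt d, ‖diff (linPart p) - diff p‖ ≤ C * ‖diff (diff p)‖ := by
  refine ⟨2 * ((‖linPartL d n‖ + 1) * (n : ℝ) ^ 2), by positivity, fun p => ?_⟩
  set u := diff p ⟨0, by omega⟩ with hu
  set q : Fin n → Pt d := fun j => p ⟨0, by omega⟩ + ((j : ℕ) : ℝ) • u with hq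
  have hq2 : diff (diff q) = 0 := by
    funext i
    simp only [diff, hq, Pi.zero_apply, Nat.cast_add, Nat.cast_one, add_smul]
    abel
  have hpq : ‖p - q‖ ≤ (n : ℝ) ^ 2 * ‖diff (diff p)‖ := by
    rw [pi_norm_le_iff_of_nonneg (by positivity)]
    intro i
    have h := norm_sub_linear_le (y := fun j => if h : j < n then p ⟨j, h⟩ else 0) (K := n - 1)
      (norm_nonneg (diff (diff p))) (fun j hj => by
        have := norm_le_pi_norm (diff (diff p)) ⟨j, by omega⟩
        rw [dif_pos (by omega), dif_pos (by omega), dif_pos (by omega)]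
        exact this) i (by omega)
    rw [dif_pos (by omega), dif_pos (by omega), dif_pos (by omega)] at h
    refine h.trans ?_
    have : ((i : ℕ) : ℝ) ≤ n := by exact_mod_cast i.2.le
    gcongr
  -- The projection fixes the linear chain `q`, so only the small remainder `p - q` contributes.
  have e : linPart p - p = linPartL d n (p - q) - (p - q) := by
    rw [map_sub, linPartL_apply, linPartL_apply, linPart_eq_self hq2]
    abel
  rw [← diff_sub, e]
  refine (norm_diff_le _).trans ?_
  have h1 := norm_sub_le (linPartL d n (p - q)) (p - q)
  have h2 := (linPartL d n).le_opNorm (p - q)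
  have h3 : (‖linPartL d n‖ + 1) * ‖p - q‖ ≤
      (‖linPartL d n‖ + 1) * ((n : ℝ) ^ 2 * ‖diff (diff p)‖) :=
    mul_le_mul_of_nonneg_left hpq (by positivity)
  nlinarith

/-- If the distortion is small, then the second differences are small relative to each of the first
differences. -/
lemma exists_norm_second_diff_le_of_distortion (d : ℕ) (hn : 2 ≤ n) :
    ∃ C : ℝ, 0 < C ∧ ∀ (p : Fin n → Pt d) (x : ℝ), 0 ≤ x → C * x ≤ 1 →
      distortion p ≤ ENNReal.ofReal x → ∀ j, diff p j ≠ 0 ∧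
        ‖diff (diff p)‖ ≤ 2 * x * ‖diff p j‖ := by
  obtain ⟨C, hC, H⟩ := exists_norm_diff_linPart_sub_le d hn
  refine ⟨2 * (C + 2 * n), by positivity, fun p x hx hCx hp j => ?_⟩
  unfold distortion at hp
  split_ifs at hp with h0
  · have hl : 0 < ‖diff (linPart p)‖ := norm_pos_iff.2 h0
    rw [ENNReal.ofReal_le_ofReal_iff hx, div_le_iff₀ hl] at hp
    have h1 : ‖diff (linPart p)‖ ≤ ‖diff p j‖ + (C + 2 * n) * ‖diff (diff p)‖ := by
      rw [pi_norm_le_iff_of_nonneg (by positivity)]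
      intro i
      have h2 := (norm_le_pi_norm (diff (linPart p) - diff p) i).trans (H p)
      have h3 := norm_diff_sub_diff_le p hn i j
      have e : diff (linPart p) i =
          diff p j + (diff p i - diff p j) + (diff (linPart p) - diff p) i := by
        rw [Pi.sub_apply]
        abel
      rw [e]
      have t1 := norm_add_le (diff p j + (diff p i - diff p j)) ((diff (linPart p) - diff p) i)
      have t2 := norm_add_le (diff p j) (diff p i - diff p j)
      linarith
    -- The smallness `C * x ≤ 1` lets half of the linear component's first difference absorb the
    -- error.
    have h2 : (C + 2 * n) * ‖diff (diff p)‖ ≤ 1 / 2 * ‖diff (linPart p)‖ := by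
      calc (C + 2 * n) * ‖diff (diff p)‖ ≤ (C + 2 * n) * (x * ‖diff (linPart p)‖) :=
            mul_le_mul_of_nonneg_left hp (by positivity)
        _ = (C + 2 * n) * x * ‖diff (linPart p)‖ := by ring
        _ ≤ _ := mul_le_mul_of_nonneg_right (by linarith) hl.le
    have h3 : ‖diff (linPart p)‖ ≤ 2 * ‖diff p j‖ := by linarith
    refine ⟨norm_pos_iff.1 (by linarith), hp.trans ?_⟩
    nlinarith
  · exact absurd hp (by simp)

lemma isFlat_of_maxDistortion {m : ℕ} (d : ℕ) (hm : 0 < m) :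
    ∃ C : ℝ, 0 < C ∧ ∀ (N : ℕ) (P : Fin N → Pt d) (x : ℝ), spread m ≤ N → 0 ≤ x → C * x ≤ 1 →
      maxDistortion (spread m) P ≤ ENNReal.ofReal x → IsFlat m (extend P) N (2 * x) := by
  obtain ⟨C, hC, H⟩ := exists_norm_second_diff_le_of_distortion (n := spread m) d
    (by simp only [spread]; omega)
  refine ⟨C, hC, fun N P x hN hx hCx hP i hi0 hi1 => ?_⟩
  have hN' : 2 * m + 1 ≤ N := hN
  -- The window starts at `i`, or at the last admissible position if `i` is too close to the end; it
  -- contains the edge and all second differences in question.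
  obtain ⟨r, hr⟩ : ∃ r : ℕ, r = min i.toNat (N - spread m) := ⟨_, rfl⟩
  simp only [spread] at hr
  have hrN : r + spread m ≤ N := by simp only [spread]; omega
  have hd : distortion (window (spread m) r hrN P) ≤ ENNReal.ofReal x := by
    refine le_trans ?_ hP
    unfold maxDistortion
    exact le_iSup₂_of_le r hrN le_rfl
  have hw := H _ x hx hCx hd ⟨i.toNat - r, by simp only [spread]; omega⟩
  have e1 : diff (window (spread m) r hrN P) ⟨i.toNat - r, by simp only [spread]; omega⟩ =
      extend P (i + 1) - extend P i := by
    rw [extend_of_mem P (by omega) hi1, extend_of_mem P hi0 (by omega)]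
    simp only [diff, window]
    congr 3 <;> omega
  rw [e1] at hw
  refine ⟨hw.1, fun j hj1 hj2 hj3 => le_trans ?_ hw.2⟩
  have hj : j.toNat - r < spread m - 1 - 1 := by simp only [spread]; omega
  refine le_trans (le_of_eq ?_) (norm_le_pi_norm _ ⟨j.toNat - r, hj⟩)
  rw [secondDiff, extend_of_mem P (by omega) hj3, extend_of_mem P (by omega) (by omega),
    extend_of_mem P (by omega) (by omega)]
  simp only [diff, window]
  congr 1
  congr 3 <;> simp only [Fin.mk.injEq] <;> omega

lemma spread_le_len {m N : ℕ} (hN : spread m ≤ N) (l : ℕ) : spread m ≤ len m N l := by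
  have hN' : 2 * m + 1 ≤ N := hN
  rw [len_eq (by omega)]
  have : 1 ≤ 2 ^ l * (N - 2 * m) := Nat.mul_pos (by positivity) (by omega)
  simp only [spread]
  omega

/-- The iterates of straightened chains become arbitrarily flat. -/
lemma IsStraightened.exists_isFlat {m N : ℕ} (hm : 0 < m) {g : Rules d m} {P : Fin N → Pt d}
    (hN : spread m ≤ N) (hP : IsStraightened g P) {σ : ℝ} (hσ : 0 < σ) :
    ∃ l₀, ∀ l, l₀ ≤ l → IsFlat m (extend (iter g P l)) (len m N l) σ := by
  obtain ⟨C, hC, H⟩ := isFlat_of_maxDistortion (m := m) d hm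
  set x := min (1 / C) (σ / 2) with hx
  have hx0 : 0 < x := lt_min (by positivity) (by positivity)
  have hev := hP.eventually (ge_mem_nhds (show (0 : ℝ≥0∞) < ENNReal.ofReal x by simpa using hx0))
  obtain ⟨l₀, hl₀⟩ := eventually_atTop.1 hev
  refine ⟨l₀, fun l hl i h0 h1 => ?_⟩
  have hCx : C * x ≤ 1 := by
    have := min_le_left (1 / C) (σ / 2)
    rw [← hx, le_div_iff₀ hC] at this
    linarith
  obtain ⟨h2, h3⟩ := H _ (iter g P l) x (spread_le_len hN l) hx0.le hCx (hl₀ l hl) i h0 h1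
  refine ⟨h2, fun j hj1 hj2 hj3 => (h3 j hj1 hj2 hj3).trans ?_⟩
  have := min_le_right (1 / C) (σ / 2)
  exact mul_le_mul_of_nonneg_right (by linarith) (norm_nonneg _)

end Distortion

/-! ### Perturbed linear subdivision -/

section CurveDeriv

variable {E : Type*} [NormedAddCommGroup E] [NormedSpace ℝ E] {m : ℕ} {φ φ' : ℝ → ℝ}

/-- Enlarging the index set from `m` to `m + 1` makes one finite sum valid on a whole neighborhood,
which a fixed sum needs for differentiation. -/
lemma curve_eventuallyEq_sum (hφ : ∀ t : ℝ, 2 * m + 1 < |t| → φ t = 0) (q : ℤ → E) (t : ℝ) :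
    ∀ᶠ s in 𝓝 t, curve φ q s = ∑ j ∈ indexSet (m + 1) t, φ (s - j) • q j := by
  filter_upwards [Metric.ball_mem_nhds t one_pos] with s hs
  refine finsum_eq_sum_of_support_subset _ fun j hj => ?_
  by_contra h
  have h1 := lt_abs_of_notMem_indexSet h
  have h2 : |t - j| ≤ |s - j| + |s - t| := by
    have := abs_sub (s - j) (s - t)
    rwa [sub_sub_sub_cancel_left] at this
  rw [Metric.mem_ball, Real.dist_eq] at hs
  push_cast at h1
  exact hj (show φ (s - j) • q j = 0 by rw [hφ _ (by linarith), zero_smul])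

lemma hasDerivAt_curve (hφ : ∀ t : ℝ, 2 * m + 1 < |t| → φ t = 0)
    (hφ' : ∀ t : ℝ, 2 * m + 1 < |t| → φ' t = 0) (hd : ∀ t, HasDerivAt φ (φ' t) t) (q : ℤ → E)
    (t : ℝ) : HasDerivAt (curve φ q) (curve φ' q t) t := by
  rw [(curve_eventuallyEq_sum hφ' q t).self_of_nhds]
  refine HasDerivAt.congr_of_eventuallyEq ?_ (curve_eventuallyEq_sum hφ q t)
  exact HasDerivAt.fun_sum fun j _ => ((hd (t - j)).comp_sub_const t j).smul_const (q j)

lemma curve_finsetSum (hφ : ∀ t : ℝ, 2 * m + 1 < |t| → φ t = 0) (s : Finset ℕ) (q : ℕ → ℤ → E)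
    (t : ℝ) : curve φ (∑ k ∈ s, q k) t = ∑ k ∈ s, curve φ (q k) t := by
  classical
  induction s using Finset.induction_on with
  | empty => simp [curve]
  | insert k s hk ih => rw [Finset.sum_insert hk, Finset.sum_insert hk, curve_add hφ, ih]

end CurveDeriv

section Perturbed

variable {E : Type*} [NormedAddCommGroup E] [NormedSpace ℝ E] {m : ℕ}
  {a : Fin 2 → Fin (m + 1) → ℝ} {β : ℝ} {φ φ₁ φ₂ : ℝ → ℝ}

/-- Linear subdivision where `r l` is added at level `l`. -/
def perturbed (a : Fin 2 → Fin (m + 1) → ℝ) (r : ℕ → ℤ → E) (l : ℕ) : ℤ → E :=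
  ∑ k ∈ Finset.range (l + 1), (linearSub E a ^ (l - k)) (r k)

lemma perturbed_add (a : Fin 2 → Fin (m + 1) → ℝ) (r : ℕ → ℤ → E) (K l : ℕ) :
    perturbed a r (K + l) = (linearSub E a ^ l) (perturbed a r K) +
      ∑ k ∈ Finset.range l, (linearSub E a ^ (K + l - (K + 1 + k))) (r (K + 1 + k)) := by
  rw [perturbed, perturbed, show K + l + 1 = K + 1 + l by ring, Finset.sum_range_add, map_sum]
  congr 1
  refine Finset.sum_congr rfl fun k hk => ?_
  rw [Finset.mem_range] at hk
  rw [← Module.End.mul_apply, ← pow_add]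
  congr 2
  omega

lemma perturbed_zero (a : Fin 2 → Fin (m + 1) → ℝ) (r : ℕ → ℤ → E) : perturbed a r 0 = r 0 := by
  simp [perturbed]

lemma perturbed_succ (a : Fin 2 → Fin (m + 1) → ℝ) (r : ℕ → ℤ → E) (l : ℕ) :
    perturbed a r (l + 1) = linearSub E a (perturbed a r l) + r (l + 1) := by
  rw [perturbed_add a r l 1]
  simp

lemma curve_perturbed (h : IsBasicLimit a β φ φ₁ φ₂) {r : ℕ → ℤ → E} {R : ℕ → ℝ}
    (hr : ∀ l j, ‖r l j‖ ≤ R l) (K : ℕ) (t : ℝ) :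
    curve φ (perturbed a r K) (2 ^ K * t) =
      ∑ k ∈ Finset.range (K + 1), curve φ (r k) (2 ^ k * t) := by
  rw [perturbed, curve_finsetSum h.support]
  refine Finset.sum_congr rfl fun k hk => ?_
  rw [Finset.mem_range] at hk
  rw [curve_linearSub_pow h _ (hr k)]
  congr 1
  have : (2 : ℝ) ^ K = 2 ^ (K - k) * 2 ^ k := by rw [← pow_add]; congr 1; omega
  rw [this]
  field_simp

/-- The limit curve of perturbed linear subdivision. -/
def perturbedCurve (φ : ℝ → ℝ) (r : ℕ → ℤ → E) (t : ℝ) : E := ∑' l : ℕ, curve φ (r l) (2 ^ l * t)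

/-- Perturbations up to a level `K` form fixed data for purely linear subdivision, which converges.
Those after `K` contribute at most a multiple of the tail of `R`, both to the iterates and to the
curve. -/
lemma perturbed_tendsto [CompleteSpace E] (h : IsBasicLimit a β φ φ₁ φ₂) {r : ℕ → ℤ → E}
    {R : ℕ → ℝ} (hr : ∀ l j, ‖r l j‖ ≤ R l) (hR : Summable R) {ε : ℝ} (hε : 0 < ε) :
    ∃ l₀, ∀ l, l₀ ≤ l → ∀ i : ℤ, ‖perturbedCurve φ r (i / 2 ^ l) - perturbed a r l i‖ ≤ ε := by
  obtain ⟨M, hM0, hM⟩ := exists_bound_of_support h.continuous h.support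
  obtain ⟨C, hC0, hC⟩ := exists_norm_linearSub_pow_le E h
  have hR0 : ∀ l, 0 ≤ R l := fun l => (norm_nonneg _).trans (hr l 0)
  set c : ℝ := (4 * m + 4) * M with hc
  have hc0 : 0 < c := by positivity
  have hf : ∀ l t, ‖curve φ (r l) (2 ^ l * t)‖ ≤ c * R l := fun l t => by
    rw [hc, mul_assoc]
    exact norm_curve_le h.support hM (hr l) _
  have hfs : ∀ t, Summable fun l : ℕ => curve φ (r l) (2 ^ l * t) := fun t =>
    Summable.of_norm_bounded (hR.mul_left c) fun l => hf l t
  obtain ⟨K, hK⟩ := ((tendsto_sum_nat_add R).eventually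
    (gt_mem_nhds (show 0 < ε / (2 * (c + C)) by positivity))).exists_forall_of_atTop
  set T := ∑' k, R (k + (K + 1)) with hT
  have hTε : (c + C) * T ≤ ε / 2 := by
    have := hK (K + 1) (by omega)
    rw [lt_div_iff₀ (by positivity)] at this
    linarith
  have hRs : Summable fun k => R (k + (K + 1)) := (summable_nat_add_iff (K + 1)).2 hR
  obtain ⟨B, hB0, hB⟩ : ∃ B, 0 < B ∧ ∀ j, ‖perturbed a r K j‖ ≤ B := by
    refine ⟨∑ k ∈ Finset.range (K + 1), C * R k + 1, ?_, fun j => ?_⟩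
    · have : 0 ≤ ∑ k ∈ Finset.range (K + 1), C * R k :=
        Finset.sum_nonneg fun k _ => mul_nonneg hC0.le (hR0 k)
      linarith
    · rw [perturbed, Finset.sum_apply]
      refine (norm_sum_le _ _).trans ((Finset.sum_le_sum fun k _ => hC _ (r k) (R k) (hr k) j).trans ?_)
      linarith
  obtain ⟨l₁, H⟩ := linearSub_pow_sub_curve_le (E := E) h (show 0 < ε / (2 * B) by positivity)
  refine ⟨K + l₁, fun l hl i => ?_⟩
  obtain ⟨n, rfl⟩ : ∃ n, l = K + n := ⟨l - K, by omega⟩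
  have h1 := H n (by omega) _ B hB i
  set t : ℝ := i / 2 ^ (K + n) with ht
  have htn : (i : ℝ) / 2 ^ n = 2 ^ K * t := by
    rw [ht, pow_add]
    field_simp
  rw [htn] at h1
  have h2 : ‖∑ k ∈ Finset.range n, (linearSub E a ^ (K + n - (K + 1 + k))) (r (K + 1 + k)) i‖ ≤
      C * T := by
    refine (norm_sum_le _ _).trans ((Finset.sum_le_sum fun k _ =>
      hC _ (r (K + 1 + k)) (R (K + 1 + k)) (hr _) i).trans ?_)
    rw [← Finset.mul_sum]
    refine mul_le_mul_of_nonneg_left ?_ hC0.le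
    simp only [add_comm (K + 1)]
    exact hRs.sum_le_tsum _ fun k _ => hR0 _
  have h3 : ‖perturbedCurve φ r t - curve φ (perturbed a r K) (2 ^ K * t)‖ ≤ c * T := by
    rw [curve_perturbed h hr, perturbedCurve, ← (hfs t).sum_add_tsum_nat_add (K + 1),
      add_sub_cancel_left]
    exact tsum_of_norm_bounded (hRs.hasSum.mul_left c) fun k => hf _ t
  have e : perturbedCurve φ r t - perturbed a r (K + n) i =
      (perturbedCurve φ r t - curve φ (perturbed a r K) (2 ^ K * t)) -
        ((linearSub E a ^ n) (perturbed a r K) i - curve φ (perturbed a r K) (2 ^ K * t)) -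
        ∑ k ∈ Finset.range n, (linearSub E a ^ (K + n - (K + 1 + k))) (r (K + 1 + k)) i := by
    rw [perturbed_add, Pi.add_apply, Finset.sum_apply]
    abel
  rw [e]
  have h4 : ε / (2 * B) * B = ε / 2 := by field_simp
  have t1 := norm_sub_le ((perturbedCurve φ r t - curve φ (perturbed a r K) (2 ^ K * t)) -
    ((linearSub E a ^ n) (perturbed a r K) i - curve φ (perturbed a r K) (2 ^ K * t)))
    (∑ k ∈ Finset.range n, (linearSub E a ^ (K + n - (K + 1 + k))) (r (K + 1 + k)) i)
  have t2 := norm_sub_le (perturbedCurve φ r t - curve φ (perturbed a r K) (2 ^ K * t))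
    ((linearSub E a ^ n) (perturbed a r K) i - curve φ (perturbed a r K) (2 ^ K * t))
  linarith

lemma contDiff_two_of_hasDerivAt {f f' f'' : ℝ → E} (hf : ∀ t, HasDerivAt f (f' t) t)
    (hf' : ∀ t, HasDerivAt f' (f'' t) t) (hc : Continuous f'') :
    ContDiff ℝ 2 f ∧ iteratedDeriv 2 f = f'' := by
  have e1 : deriv f = f' := funext fun t => (hf t).deriv
  have e2 : deriv f' = f'' := funext fun t => (hf' t).deriv
  have h1 : ContDiff ℝ 1 f' :=
    contDiff_one_iff_deriv.2 ⟨fun t => (hf' t).differentiableAt, by rwa [e2]⟩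
  refine ⟨?_, by rw [iteratedDeriv_two, e1, e2]⟩
  have : ContDiff ℝ (1 + 1) f :=
    contDiff_succ_iff_deriv.2 ⟨fun t => (hf t).differentiableAt, by simp, by rwa [e1]⟩
  simpa [one_add_one_eq_two] using this

/-- The limit curve is of class `C^{2,β}` if the perturbations decay fast enough. -/
lemma perturbedCurve_holder [CompleteSpace E] (h : IsBasicLimit a β φ φ₁ φ₂) (hβ : 0 < β)
    {r : ℕ → ℤ → E} {R : ℕ → ℝ} (hr : ∀ l j, ‖r l j‖ ≤ R l)
    (hR : Summable fun l => (4 * 2 ^ β) ^ l * R l) :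
    ContDiff ℝ 2 (perturbedCurve φ r) ∧ ∃ C, ∀ x y,
      ‖iteratedDeriv 2 (perturbedCurve φ r) x - iteratedDeriv 2 (perturbedCurve φ r) y‖ ≤
        C * |x - y| ^ β := by
  obtain ⟨M, hM0, hM⟩ := exists_bound_of_support h.continuous h.support
  obtain ⟨M₁, hM₁0, hM₁⟩ := exists_bound_of_support h.continuous₁ h.support₁
  obtain ⟨M₂, hM₂0, hM₂⟩ := exists_bound_of_support (h.continuous₂ hβ) h.support₂
  obtain ⟨H, hH0, hH⟩ := h.holder
  have hR0 : ∀ l, 0 ≤ R l := fun l => (norm_nonneg _).trans (hr l 0)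
  have hb1 : (1 : ℝ) ≤ 2 ^ β := Real.one_le_rpow (by norm_num) hβ.le
  -- As `2 ^ β ≥ 1`, the single weight `(4 * 2 ^ β) ^ l` dominates those of the series for the curve
  -- and for its two derivatives.
  have hs : ∀ (b c : ℝ), 0 ≤ c → 0 ≤ b → b ≤ 4 → Summable fun l => b ^ l * (c * R l) := by
    intro b c hc hb0 hb
    refine Summable.of_nonneg_of_le (fun l => ?_) (fun l => ?_) (hR.mul_left c)
    · have := hR0 l
      positivity
    · have h1 : b ^ l ≤ (4 * 2 ^ β) ^ l := by
        refine pow_le_pow_left₀ hb0 ?_ l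
        linarith
      have := mul_le_mul_of_nonneg_right h1 (mul_nonneg hc (hR0 l))
      linarith
  have hd : ∀ (l : ℕ) (t : ℝ), HasDerivAt (fun t => (2 : ℝ) ^ l * t) (2 ^ l) t := fun l t => by
    simpa using (hasDerivAt_id t).const_mul ((2 : ℝ) ^ l)
  set F₁ : ℝ → E := fun t => ∑' l : ℕ, (2 : ℝ) ^ l • curve φ₁ (r l) (2 ^ l * t) with hF₁
  set F₂ : ℝ → E := fun t => ∑' l : ℕ, (2 : ℝ) ^ l • (2 : ℝ) ^ l • curve φ₂ (r l) (2 ^ l * t) with hF₂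
  have b0 : ∀ (l : ℕ) (t : ℝ), ‖curve φ (r l) (2 ^ l * t)‖ ≤ 1 ^ l * ((4 * m + 4) * M * R l) :=
    fun l t => by
      rw [one_pow, one_mul, mul_assoc]
      exact norm_curve_le h.support hM (hr l) _
  have b1 : ∀ (l : ℕ) (t : ℝ), ‖(2 : ℝ) ^ l • curve φ₁ (r l) (2 ^ l * t)‖ ≤
      2 ^ l * ((4 * m + 4) * M₁ * R l) := fun l t => by
    rw [norm_smul, norm_pow, Real.norm_of_nonneg zero_le_two, mul_assoc (4 * (m : ℝ) + 4)]
    exact mul_le_mul_of_nonneg_left (norm_curve_le h.support₁ hM₁ (hr l) _) (by positivity)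
  have b2 : ∀ (l : ℕ) (t : ℝ), ‖(2 : ℝ) ^ l • (2 : ℝ) ^ l • curve φ₂ (r l) (2 ^ l * t)‖ ≤
      4 ^ l * ((4 * m + 4) * M₂ * R l) := fun l t => by
    rw [smul_smul, ← mul_pow, norm_smul, norm_pow, mul_assoc (4 * (m : ℝ) + 4)]
    norm_num only [Real.norm_ofNat]
    exact mul_le_mul_of_nonneg_left (norm_curve_le h.support₂ hM₂ (hr l) _) (by positivity)
  have s0 := hs 1 ((4 * m + 4) * M) (by positivity) zero_le_one (by norm_num)
  have s1 := hs 2 ((4 * m + 4) * M₁) (by positivity) zero_le_two (by norm_num)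
  have s2 := hs 4 ((4 * m + 4) * M₂) (by positivity) (by norm_num) le_rfl
  have D0 : ∀ t, HasDerivAt (perturbedCurve φ r) (F₁ t) t := fun t =>
    hasDerivAt_tsum (y₀ := 0) s1 (fun l t =>
      (hasDerivAt_curve h.support h.support₁ h.hasDerivAt (r l) (2 ^ l * t)).scomp t (hd l t)) b1
      (Summable.of_norm_bounded s0 fun l => b0 l 0) t
  have D1 : ∀ t, HasDerivAt F₁ (F₂ t) t := fun t =>
    hasDerivAt_tsum (y₀ := 0) s2 (fun l t =>
      ((hasDerivAt_curve h.support₁ h.support₂ h.hasDerivAt₁ (r l) (2 ^ l * t)).scomp t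
        (hd l t)).const_smul ((2 : ℝ) ^ l)) b2 (Summable.of_norm_bounded s1 fun l => b1 l 0) t
  set C := ∑' l, (8 * m + 8) * H * ((4 * 2 ^ β) ^ l * R l) with hC
  have hol : ∀ x y, ‖F₂ x - F₂ y‖ ≤ C * |x - y| ^ β := by
    intro x y
    rw [hF₂, hC, ← tsum_mul_right]
    simp only
    rw [← (Summable.of_norm_bounded s2 fun l => b2 l x).tsum_sub
      (Summable.of_norm_bounded s2 fun l => b2 l y)]
    refine tsum_of_norm_bounded (((hR.mul_left ((8 * m + 8) * H)).mul_right _).hasSum) fun l => ?_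
    rw [← smul_sub, ← smul_sub, smul_smul, ← mul_pow, norm_smul, norm_pow]
    norm_num only [Real.norm_ofNat]
    have key := norm_curve_sub_le (φ := φ₂) (δ := H * |2 ^ l * x - 2 ^ l * y| ^ β) h.support₂
      (x := 2 ^ l * x) (y := 2 ^ l * y) (fun j => by
        simpa using hH (2 ^ l * x - j) (2 ^ l * y - j)) (hr l)
    refine (mul_le_mul_of_nonneg_left key (by positivity)).trans (le_of_eq ?_)
    have e : |2 ^ l * x - 2 ^ l * y| ^ β = ((2 : ℝ) ^ β) ^ l * |x - y| ^ β := by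
      rw [← mul_sub, abs_mul, abs_of_pos (by positivity : (0 : ℝ) < 2 ^ l),
        Real.mul_rpow (by positivity) (abs_nonneg _), Real.rpow_pow_comm zero_le_two]
    rw [e, mul_pow]
    ring
  have hcont : Continuous F₂ := by
    refine continuous_tsum (fun l => ?_) s2 b2
    have : Continuous (curve φ₂ (r l)) := by
      refine continuous_iff_continuousAt.2 fun t => ?_
      refine ContinuousAt.congr ?_ ((curve_eventuallyEq_sum h.support₂ (r l) t).mono
        fun _ hs => hs.symm)
      have hc2 := h.continuous₂ hβ
      fun_prop
    fun_prop
  obtain ⟨h1, h2⟩ := contDiff_two_of_hasDerivAt D0 D1 hcont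
  exact ⟨h1, C, by rwa [h2]⟩

end Perturbed

/-- A perturbation from level `k` has been refined `l - k` times, so its second differences have
shrunk by `4 ^ (l - k)`. -/
lemma norm_secondDiff_perturbed_le {d m : ℕ} {a : Fin 2 → Fin (m + 1) → ℝ} {C : ℝ}
    (hC : ∀ (l : ℕ) (q : ℤ → Pt d) (B : ℝ), (∀ j, ‖q j‖ ≤ B) → ∀ i : ℤ,
      ‖secondDiff ((linearSub (Pt d) a ^ l) q) i‖ ≤ C * ((1 / 4) ^ l * B))
    {r : ℕ → ℤ → Pt d} {R : ℕ → ℝ} (hr : ∀ l j, ‖r l j‖ ≤ R l) (l : ℕ) (i : ℤ) :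
    ‖secondDiff (perturbed a r l) i‖ ≤
      C * ((∑ k ∈ Finset.range (l + 1), 4 ^ k * R k) / 4 ^ l) := by
  have e : secondDiff (perturbed a r l) i =
      ∑ k ∈ Finset.range (l + 1), secondDiff ((linearSub (Pt d) a ^ (l - k)) (r k)) i := by
    simp only [secondDiff, perturbed, Finset.sum_apply, Finset.sum_sub_distrib]
  rw [e, Finset.sum_div, Finset.mul_sum]
  refine (norm_sum_le _ _).trans (Finset.sum_le_sum fun k hk => (hC _ _ _ (hr k) i).trans ?_)
  rw [Finset.mem_range] at hk
  have : (4 : ℝ) ^ l = 4 ^ (l - k) * 4 ^ k := by rw [← pow_add]; congr 1; omega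
  rw [this, one_div_pow]
  apply le_of_eq
  field_simp

/-! ### Decay of the deviation from the linear companion -/

section Growth

lemma exists_le_geometric {S : ℕ → ℝ} {b : ℝ} {l₀ : ℕ} (hb : 1 ≤ b) (hS : ∀ l, 0 ≤ S l)
    (h : ∀ l, l₀ ≤ l → S (l + 1) ≤ b * S l) : ∀ l, l₀ ≤ l → S l ≤ (S l₀ + 1) * b ^ l := by
  intro l hl
  induction l, hl using Nat.le_induction with
  | base =>
    have := one_le_pow₀ hb (n := l₀)
    nlinarith [hS l₀]
  | succ l hl ih =>
    calc S (l + 1) ≤ b * S l := h l hl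
      _ ≤ b * ((S l₀ + 1) * b ^ l) := mul_le_mul_of_nonneg_left ih (by linarith)
      _ = _ := by ring

/-- At `ε = 0` the left side is `2 ^ (β - ν) < 1`, and it is continuous there. The bound `ε < 1 / 2`
keeps `(1 - ε) / 2` positive. -/
lemma exists_growth_rate {β ν : ℝ} (h : β < ν) :
    ∃ ε : ℝ, 0 < ε ∧ ε < 1 / 2 ∧
      4 * 2 ^ β * (((1 + ε) / 4 / ((1 - ε) / 2)) ^ ν * ((1 + ε) / 4)) < 1 := by
  have hc : ContinuousAt (fun ε : ℝ =>
      4 * 2 ^ β * (((1 + ε) / 4 / ((1 - ε) / 2)) ^ ν * ((1 + ε) / 4))) 0 := by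
    refine continuousAt_const.mul (ContinuousAt.mul (ContinuousAt.rpow_const ?_ (Or.inl ?_)) ?_)
    · exact ContinuousAt.div (by fun_prop) (by fun_prop) (by norm_num)
    · norm_num
    · fun_prop
  have h0 : 4 * 2 ^ β * (((1 + (0 : ℝ)) / 4 / ((1 - 0) / 2)) ^ ν * ((1 + 0) / 4)) < 1 := by
    have e : ((1 + (0 : ℝ)) / 4 / ((1 - 0) / 2)) = 2⁻¹ := by norm_num
    rw [e, Real.inv_rpow zero_le_two]
    have h1 : (2 : ℝ) ^ β < 2 ^ ν := Real.rpow_lt_rpow_of_exponent_lt one_lt_two h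
    have h2 : (0 : ℝ) < 2 ^ ν := by positivity
    have e2 : 4 * (2 : ℝ) ^ β * (((2 : ℝ) ^ ν)⁻¹ * ((1 + 0) / 4)) = 2 ^ β / 2 ^ ν := by
      field_simp
      norm_num
    rw [e2, div_lt_one h2]
    exact h1
  have hev := (hc.eventually (gt_mem_nhds h0)).and
    (gt_mem_nhds (show (0 : ℝ) < 1 / 2 by norm_num))
  obtain ⟨ε, ⟨h1, h2⟩, h3⟩ := ((hev.filter_mono nhdsWithin_le_nhds).and
    (self_mem_nhdsWithin (a := (0 : ℝ)) (s := Set.Ioi 0))).exists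
  exact ⟨ε, h3, h2, h1⟩

end Growth

section Main

variable {d m N : ℕ} {g : Rules d m} {ν : ℝ}
  {A : Fin 2 → Matrix (Fin (spread m)) (Fin (spread m)) ℝ}

/-- The same deviation is bounded twice: by a small multiple of `D`, which starts the bootstrap, and
by a power of `D` above one, which gives the final rate. -/
lemma exists_flat_rule_sub_linearSub_le [NeZero d] (hm : 0 < m) (hG : IsGLUE g ν)
    (hA : IsLocallyLinear g A) :
    ∃ C δ : ℝ, 0 < C ∧ 0 < δ ∧ ∀ (p : ℤ → Pt d) (N : ℤ) (σ D : ℝ), 0 ≤ σ → σ ≤ δ →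
      IsFlat m p N σ → 0 ≤ D → (∀ j, 0 ≤ j → j + 2 < N → ‖secondDiff p j‖ ≤ D) →
      ∀ k, 0 ≤ k → k < 2 * (N - m) →
        ‖g (parity k) (fun j => p (k / 2 + (j : ℕ))) - linearSub (Pt d) (companionWeights A) p k‖ ≤
          C * σ ^ ν * D ∧
        ∀ ρ, 0 < ρ → ρ ≤ ‖p (k / 2 + 1) - p (k / 2)‖ →
          ‖g (parity k) (fun j => p (k / 2 + (j : ℕ))) -
            linearSub (Pt d) (companionWeights A) p k‖ ≤ C * (D / ρ) ^ ν * D := by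
  obtain ⟨C, δ, hC, hδ, H⟩ := exists_rule_sub_linearSub_le hm hG hA
  have hν := hG.regularity_pos
  refine ⟨C, δ, hC, hδ, fun p N σ D hσ0 hσ hp hD hpD k hk0 hk1 => ?_⟩
  obtain ⟨hu, hsd⟩ := hp (k / 2) (by omega) (by omega)
  set u := p (k / 2 + 1) - p (k / 2) with hu'
  have hu0 : 0 < ‖u‖ := norm_pos_iff.2 hu
  -- The minimum is still a bound for the second differences; its two entries yield the two
  -- estimates.
  set D' := min D (σ * ‖u‖) with hD'
  have hD'0 : 0 ≤ D' := le_min hD (by positivity)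
  have hD'1 : D' ≤ D := min_le_left _ _
  have hD'2 : D' ≤ σ * ‖u‖ := min_le_right _ _
  have key := H p k (k / 2) D' rfl hD'0 (fun j hj1 hj2 => le_min (hpD j (by omega) (by omega))
    (hsd j hj1 (by omega) (by omega))) hu (hD'2.trans (mul_le_mul_of_nonneg_right hσ hu0.le))
  refine ⟨key.trans ?_, fun ρ hρ hρu => key.trans ?_⟩
  · have : D' / ‖u‖ ≤ σ := (div_le_iff₀ hu0).2 hD'2
    gcongr
  · gcongr

lemma exists_pos_le_norm_first_diff {p : ℤ → Pt d} {N : ℤ}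
    (h : ∀ i, 0 ≤ i → i + 1 < N → p (i + 1) - p i ≠ 0) :
    ∃ ρ : ℝ, 0 < ρ ∧ ∀ i, 0 ≤ i → i + 1 < N → ρ ≤ ‖p (i + 1) - p i‖ := by
  rcases (Finset.Ico 0 (N - 1)).eq_empty_or_nonempty with he | hne
  · refine ⟨1, one_pos, fun i h0 h1 => ?_⟩
    exact absurd (he ▸ Finset.mem_Ico.2 ⟨h0, by omega⟩) (Finset.notMem_empty i)
  · obtain ⟨i, hi, hmin⟩ := Finset.exists_min_image _ (fun i => ‖p (i + 1) - p i‖) hne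
    rw [Finset.mem_Ico] at hi
    refine ⟨‖p (i + 1) - p i‖, norm_pos_iff.2 (h i hi.1 (by omega)), fun j h0 h1 => ?_⟩
    exact hmin j (Finset.mem_Ico.2 ⟨h0, by omega⟩)

/-- The initial chain at level `0` and the deviation from the linear scheme at the other levels. -/
def deviation (g : Rules d m) (a : Fin 2 → Fin (m + 1) → ℝ) (P : Fin N → Pt d) : ℕ → ℤ → Pt d
  | 0 => extend P
  | l + 1 => fun k => if 0 ≤ k ∧ k < len m N (l + 1) then
      extend (iter g P (l + 1)) k - linearSub (Pt d) a (extend (iter g P l)) k else 0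

lemma norm_extend_le (P : Fin N → Pt d) (i : ℤ) : ‖extend P i‖ ≤ ‖P‖ := by
  unfold extend
  split_ifs
  · exact norm_le_pi_norm P _
  · rw [norm_zero]
    exact norm_nonneg _

/-- Without boundedness the real supremum would default to `0` and bound nothing. -/
lemma bddAbove_deviation (g : Rules d m) (a : Fin 2 → Fin (m + 1) → ℝ) (P : Fin N → Pt d) (l : ℕ) :
    BddAbove (Set.range fun j => ‖deviation g a P l j‖) := by
  cases l with
  | zero => exact ⟨‖P‖, by rintro _ ⟨j, rfl⟩; exact norm_extend_le P j⟩
  | succ l =>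
    refine ⟨‖iter g P (l + 1)‖ + (1 + ∑ s, ∑ j, |a s j|) * ‖iter g P l‖, ?_⟩
    rintro _ ⟨j, rfl⟩
    have h1 := norm_extend_le (iter g P (l + 1)) j
    have h2 := norm_linearSub_le a (norm_extend_le (iter g P l)) j
    simp only [deviation]
    split_ifs
    · exact (norm_sub_le _ _).trans (add_le_add h1 h2)
    · rw [norm_zero]
      exact add_nonneg ((norm_nonneg _).trans h1) ((norm_nonneg _).trans h2)

/-- Each `r l` restores exactly what the linear step misses. Indices in range read only indices in
range, so cutting `r l` to zero elsewhere does no harm. -/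
lemma perturbed_deviation (g : Rules d m) (a : Fin 2 → Fin (m + 1) → ℝ) (P : Fin N → Pt d)
    (l : ℕ) : ∀ k : ℤ, 0 ≤ k → k < len m N l →
      perturbed a (deviation g a P) l k = extend (iter g P l) k := by
  induction l with
  | zero =>
    intro k _ _
    rw [perturbed_zero]
    rfl
  | succ l ih =>
    intro k h0 h1
    have h2 : linearSub (Pt d) a (perturbed a (deviation g a P) l) k =
        linearSub (Pt d) a (extend (iter g P l)) k := by
      rw [linearSub_apply, linearSub_apply]
      refine Finset.sum_congr rfl fun j _ => ?_
      have := j.2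
      simp only [len] at h1
      rw [ih _ (by omega) (by omega)]
    rw [perturbed_succ, Pi.add_apply, h2, deviation]
    simp only
    rw [if_pos ⟨h0, h1⟩]
    abel

/-- The deviation decays fast enough for the limit curve to be of class `C^{2,β}`, `β < ν`. -/
lemma summable_deviation [NeZero d] (hm : 0 < m) (hG : IsGLUE g ν) (hA : IsLocallyLinear g A)
    {β : ℝ} (hβν : β < ν) (hN : spread m ≤ N) {P : Fin N → Pt d} (hP : IsStraightened g P) {C₂ : ℝ}
    (hC₂ : 0 < C₂) (hC : ∀ (l : ℕ) (q : ℤ → Pt d) (B : ℝ), (∀ j, ‖q j‖ ≤ B) → ∀ i : ℤ,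
      ‖secondDiff ((linearSub (Pt d) (companionWeights A) ^ l) q) i‖ ≤ C₂ * ((1 / 4) ^ l * B)) :
    Summable fun l => (4 * 2 ^ β) ^ l * ⨆ j, ‖deviation g (companionWeights A) P l j‖ := by
  have hν := hG.regularity_pos
  set a := companionWeights A with ha
  set r := deviation g a P with hr
  set R : ℕ → ℝ := fun l => ⨆ j, ‖r l j‖ with hR
  have hrR : ∀ l j, ‖r l j‖ ≤ R l := fun l j => le_ciSup (bddAbove_deviation g a P l) j
  have hR0 : ∀ l, 0 ≤ R l := fun l => (norm_nonneg _).trans (hrR l 0)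
  obtain ⟨C₁, δ₁, hC₁, hδ₁, H₁⟩ := exists_flat_rule_sub_linearSub_le hm hG hA
  obtain ⟨C₃, δ₃, hC₃, hδ₃, H₃⟩ := exists_le_norm_first_diff hm hG hA
  obtain ⟨ε, hε0, hε1, hθ⟩ := exists_growth_rate hβν
  -- Chosen such that `σ ≤ η` gives `4 * C₁ * C₂ * σ ^ ν ≤ ε`, the growth allowed to `S` per level.
  set η := (ε / (4 * C₁ * C₂)) ^ ν⁻¹ with hη
  have hη0 : 0 < η := Real.rpow_pos_of_pos (by positivity) _
  obtain ⟨σ, hσ0, hσ₁, hσ₃, hση, hσε⟩ : ∃ σ : ℝ, 0 < σ ∧ σ ≤ δ₁ ∧ σ ≤ δ₃ ∧ σ ≤ η ∧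
      σ ≤ ε / (2 * C₃) := by
    refine ⟨min (min δ₁ δ₃) (min η (ε / (2 * C₃))), by positivity, ?_, ?_, ?_, ?_⟩
    · exact (min_le_left _ _).trans (min_le_left _ _)
    · exact (min_le_left _ _).trans (min_le_right _ _)
    · exact (min_le_right _ _).trans (min_le_left _ _)
    · exact (min_le_right _ _).trans (min_le_right _ _)
  have hσν : 4 * C₁ * C₂ * σ ^ ν ≤ ε := by
    have h1 : σ ^ ν ≤ η ^ ν := Real.rpow_le_rpow hσ0.le hση hν.le
    rw [hη, Real.rpow_inv_rpow (by positivity) hν.ne', le_div_iff₀ (by positivity)] at h1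
    linarith
  obtain ⟨l₀, hflat⟩ := hP.exists_isFlat hm hN hσ0
  set S : ℕ → ℝ := fun l => ∑ k ∈ Finset.range (l + 1), 4 ^ k * R k with hS
  have hS0 : ∀ l, 0 ≤ S l := fun l =>
    Finset.sum_nonneg fun k _ => mul_nonneg (by positivity) (hR0 k)
  have hlen : ∀ l, ((len m N (l + 1) : ℕ) : ℤ) = 2 * ((len m N l : ℕ) - m) := by
    intro l
    have : m ≤ len m N l := by
      have := spread_le_len hN l
      simp only [spread] at this
      omega
    simp only [len]
    push_cast [this]
    rfl
  have hsd : ∀ (l : ℕ) (j : ℤ), 0 ≤ j → j + 2 < len m N l →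
      ‖secondDiff (extend (iter g P l)) j‖ ≤ C₂ * (S l / 4 ^ l) := by
    intro l j h0 h1
    have := norm_secondDiff_perturbed_le hC hrR l j
    rwa [secondDiff, hr, perturbed_deviation _ _ _ _ _ (by omega) h1,
      perturbed_deviation _ _ _ _ _ (by omega) (by omega),
      perturbed_deviation _ _ _ _ _ h0 (by omega)] at this
  have hRle : ∀ (l : ℕ) (B : ℝ), 0 ≤ B → (∀ k : ℤ, 0 ≤ k → k < 2 * ((len m N l : ℕ) - m) →
      ‖g (parity k) (fun j => extend (iter g P l) (k / 2 + (j : ℕ))) -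
        linearSub (Pt d) a (extend (iter g P l)) k‖ ≤ B) → R (l + 1) ≤ B := by
    intro l B hB h
    refine ciSup_le fun k => ?_
    simp only [hr, deviation]
    split_ifs with hk
    · rw [extend_iter_succ _ _ _ hk.1 hk.2]
      exact h k hk.1 (by rw [← hlen]; exact hk.2)
    · rwa [norm_zero]
  have hDpos : ∀ l, 0 ≤ C₂ * (S l / 4 ^ l) := fun l =>
    mul_nonneg hC₂.le (div_nonneg (hS0 l) (by positivity))
  -- Bootstrap: the next deviation is controlled by the second differences, which are controlled by
  -- the earlier deviations collected in `S`.
  have hSstep : ∀ l, l₀ ≤ l → S (l + 1) ≤ (1 + ε) * S l := by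
    intro l hl
    have h1 : R (l + 1) ≤ C₁ * σ ^ ν * (C₂ * (S l / 4 ^ l)) :=
      hRle l _ (mul_nonneg (by positivity) (hDpos l)) fun k h0 h1 =>
        (H₁ _ _ σ _ hσ0.le hσ₁ (hflat l hl) (hDpos l) (hsd l) k h0 h1).1
    have h2 : S (l + 1) = S l + 4 ^ (l + 1) * R (l + 1) := Finset.sum_range_succ _ _
    have h3 : 4 ^ (l + 1) * R (l + 1) ≤ 4 * C₁ * C₂ * σ ^ ν * S l := by
      refine (mul_le_mul_of_nonneg_left h1 (by positivity)).trans (le_of_eq ?_)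
      rw [pow_succ]
      field_simp
    nlinarith [hS0 l]
  have hSle := exists_le_geometric (by linarith : 1 ≤ 1 + ε) hS0 hSstep
  set s₀ := S l₀ + 1 with hs₀
  have hs₀0 : 0 < s₀ := by linarith [hS0 l₀]
  obtain ⟨ρ, hρ0, hρ⟩ := exists_pos_le_norm_first_diff fun i h0 h1 =>
    (hflat l₀ le_rfl i h0 h1).1
  set b := (1 - ε) / 2 with hb
  have hb0 : 0 < b := by rw [hb]; linarith
  have hb1 : b ≤ 1 := by rw [hb]; linarith
  -- Each step keeps at least the fraction `1 / 2 - C₃ * σ ≥ b` of an edge, by the choice `σ ≤ ε /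
  -- (2 * C₃)`.
  have hfd : ∀ l, l₀ ≤ l → ∀ i : ℤ, 0 ≤ i → i + 1 < len m N l →
      ρ * b ^ l ≤ ‖extend (iter g P l) (i + 1) - extend (iter g P l) i‖ := by
    intro l hl
    induction l, hl using Nat.le_induction with
    | base =>
      intro i h0 h1
      exact (mul_le_of_le_one_right hρ0.le (pow_le_one₀ hb0.le hb1)).trans (hρ i h0 h1)
    | succ l hl ih =>
      intro i h0 h1
      have hl' := hlen l
      have h2 := H₃ _ _ σ hσ0.le hσ₃ (hflat l hl) i h0 (by omega)
      rw [← extend_iter_succ g P l (by omega) h1, ← extend_iter_succ g P l h0 (by omega)] at h2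
      refine le_trans ?_ h2
      have h3 := ih (i / 2) (by omega) (by omega)
      have h4 : b ≤ 1 / 2 - C₃ * σ := by
        rw [le_div_iff₀ (by positivity)] at hσε
        rw [hb]
        linarith
      calc ρ * b ^ (l + 1) = b * (ρ * b ^ l) := by ring
        _ ≤ _ := mul_le_mul h4 h3 (by positivity) (hb0.le.trans h4)
  set b' := (1 + ε) / 4 with hb'
  have hb'0 : 0 < b' := by positivity
  set θ := (b' / b) ^ ν * b' with hθ'
  set c := C₁ * (C₂ * s₀ / ρ) ^ ν * (C₂ * s₀) with hc
  -- Second pass, now with explicit rates `b' ^ l` for second differences and `b ^ l` for edges.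
  have hRθ : ∀ l, l₀ ≤ l → R (l + 1) ≤ c * θ ^ l := by
    intro l hl
    have hD : C₂ * (S l / 4 ^ l) ≤ C₂ * s₀ * b' ^ l := by
      have := hSle l hl
      rw [hb', div_pow, mul_assoc, ← mul_div_assoc s₀]
      gcongr
    have h1 : R (l + 1) ≤
        C₁ * (C₂ * s₀ * b' ^ l / (ρ * b ^ l)) ^ ν * (C₂ * s₀ * b' ^ l) :=
      hRle l _ (by positivity) fun k h0 h1 =>
        (H₁ _ _ σ _ hσ0.le hσ₁ (hflat l hl) (by positivity)
          (fun j hj0 hj1 => (hsd l j hj0 hj1).trans hD) k h0 h1).2 _ (by positivity)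
          (hfd l hl _ (by omega) (by omega))
    refine h1.trans (le_of_eq ?_)
    rw [mul_div_mul_comm, ← div_pow, Real.mul_rpow (by positivity) (by positivity),
      ← Real.rpow_pow_comm (by positivity), hc, hθ', mul_pow]
    ring
  rw [← summable_nat_add_iff (l₀ + 1)]
  have hb2 : (0 : ℝ) < 2 ^ β := by positivity
  have hgeo : Summable fun l : ℕ => 4 * 2 ^ β * c * (4 * 2 ^ β * θ) ^ (l + l₀) :=
    ((summable_nat_add_iff l₀).2
      (summable_geometric_of_lt_one (by positivity) hθ)).mul_left _
  refine Summable.of_nonneg_of_le (fun l => mul_nonneg (by positivity) (hR0 _)) (fun l => ?_) hgeo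
  have h1 := hRθ (l + l₀) (by omega)
  calc (4 * 2 ^ β) ^ (l + (l₀ + 1)) * R (l + (l₀ + 1))
      ≤ (4 * 2 ^ β) ^ (l + (l₀ + 1)) * (c * θ ^ (l + l₀)) :=
        mul_le_mul_of_nonneg_left h1 (by positivity)
    _ = _ := by
      rw [← add_assoc, pow_succ, mul_pow (4 * 2 ^ β) θ]
      ring

end Main

end Subdiv

end

/-! ### The main theorem -/

theorem mainTheorem2 {d m N : ℕ} [NeZero d] (hm : 0 < m)
    (g : Subdiv.Rules d m) (ν : ℝ) (hG : Subdiv.IsGLUE g ν)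
    (A : Fin 2 → Matrix (Fin (Subdiv.spread m)) (Fin (Subdiv.spread m)) ℝ)
    (hA : Subdiv.IsLocallyLinear g A)
    (α : ℝ) (hα₀ : 0 < α) (hα₁ : α ≤ 1)
    (hAα : Subdiv.IsAlmostHolderLinear d (Subdiv.companionWeights A) 2 α)
    (hN : Subdiv.spread m ≤ N) (P : Fin N → Subdiv.Pt d)
    (hP : Subdiv.IsStraightened g P) :
    Subdiv.IsAlmostHolderAt g 2 (min α ν) P := by
  open Subdiv in
  intro β hβ0 hβ
  obtain ⟨hβα, hβν⟩ := lt_min_iff.1 hβ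
  obtain ⟨φ, φ₁, φ₂, h⟩ := exists_isBasicLimit (companionWeights A) hβ0
    (hAα.1 (6 * m + 4) (bumpChain d m) (by simp only [spread]; omega) β hβ0 hβα)
  obtain ⟨C₂, hC₂, hC⟩ := exists_second_diff_linearSub_pow_le h hβ0
    (sum_companionWeights hG hA) hAα.2
  set r := deviation g (companionWeights A) P with hr
  have hsum := summable_deviation hm hG hA hβν hN hP hC₂ hC
  have hrR : ∀ l j, ‖r l j‖ ≤ ⨆ j, ‖r l j‖ := fun l j =>
    le_ciSup (bddAbove_deviation g (companionWeights A) P l) j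
  have hR : Summable fun l => ⨆ j, ‖r l j‖ := by
    have hb1 : (1 : ℝ) ≤ 2 ^ β := Real.one_le_rpow (by norm_num) hβ0.le
    refine Summable.of_nonneg_of_le (fun l => (norm_nonneg _).trans (hrR l 0)) (fun l => ?_) hsum
    exact le_mul_of_one_le_left ((norm_nonneg _).trans (hrR l 0))
      (one_le_pow₀ (by linarith))
  obtain ⟨hcd, C, hhol⟩ := perturbedCurve_holder h hβ0 hrR hsum
  -- The curve is `C^{2,β}` on all of `ℝ` with one constant, so `h₀ = 1` and any `z` will do.
  refine ⟨perturbedCurve φ r, ⟨hcd.continuous, fun z hz ε hε => ?_⟩, hcd.contDiffOn, 1, one_pos,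
    fun z hz => ⟨C, fun t ht _ s _ => ?_⟩⟩
  · obtain ⟨l₀, H⟩ := perturbed_tendsto h hrR hR hε
    refine ⟨l₀, fun l hl i _ _ => ?_⟩
    have := H l hl (i : ℕ)
    rw [hr, perturbed_deviation _ _ _ _ _ (by omega) (by exact_mod_cast i.2), extend_apply,
      Int.cast_natCast] at this
    exact this
  · have := hhol (s + t / 2) (s - t / 2)
    rwa [show s + t / 2 - (s - t / 2) = t by ring, abs_of_pos ht] at this
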